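/- Let $b\ge 1$ be an integer and put $r=\frac{b}{2b+1}$. The bubble-diamond graphs $G_\ell=(V_\ell,E_\ell)$ start with $G_0$, two vertices $q_1,q_2$ joined by one edge; $G_{\ell+1}$ arises from $G_\ell$ by replacing every edge $\{x,y\}$ by two new vertices $x',y'$, one edge $\{x,x'\}$, one edge $\{y,y'\}$ and $b$ parallel edges between $x'$ and $y'$. In $G_1$ let $p_1,p_2$ be the new neighbours of $q_1,q_2$. Let $V_*=\bigcup_\ell V_\ell$ and let $F_1,\dots,F_{b+2}:V_*\to V_*$ be the maps that identify $V_*$ with its $b+2$ copies lying over the edges of $G_1$, where $F_i(q_1)=p_1$, $F_i(q_2)=p_2$ for $1\le i\le b$, $F_{b+1}(q_1)=q_1$, $F_{b+1}(q_2)=p_1$, and $F_{b+2}(q_1)=p_2$, $F_{b+2}(q_2)=q_2$. For $f:V_*\to\mathbb R$ let $\mathcal E(f)=\lim_{\ell\to\infty} r^{-\ell}\sum_{\{x,y\}\in E_\ell}|f(x)-f(y)|^2\in[0,\infty]$ (parallel edges counted separately; the sequence is nondecreasing), and let $\mathcal E(f,g)$ be the bilinear form obtained by polarization for $f,g$ of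 finite energy. The resistance metric $R(x,y)$ is the least $R$ with $|f(x)-f(y)|^2\le R\,\mathcal E(f)$ for all $f$ of finite energy; the bubble-diamond fractal $K_b$ is the completion of $(V_*,R)$; functions of finite energy are extended continuously to $K_b$, and the $F_i$ to maps of $K_b$. Let $\mu$ be the self-similar probability measure on $K_b$, $\mu(A)=\frac1{b+2}\sum_{i=1}^{b+2}\mu(F_i^{-1}A)$. For $u$ of finite energy and $f$ continuous on $K_b$, write $\Delta u=f$ if $\mathcal E(u,g)=-\int_{K_b}fg\,d\mu$ for all $g$ of finite energy with $g(q_1)=g(q_2)=0$. For every $j\ge0$ and $k\in\{1,2\}$ there is a unique function $f_{jk}$ with $\Delta^{j+1}f_{jk}=0$ and $\Delta^m f_{jk}(q_n)=\delta_{jm}\delta_{kn}$ for $0\le m\le j$, $n\in\{1,2\}$. Put $I(jk,j'k')=\int_{K_b}f_{jk}f_{j'k'}\,d\mu$ and, for $\ell\ge0$, $\{k,n\}=\{1,2\}$ and $1\le i\le b$, $$a_\ell=I(\ell k,0k),\qquad b_\ell=I(\ell k,0n),$$ $$p_\ell=\Big(\frac r{b+2}\Big)^{-\ell}f_{\ell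 k}(F_iq_k)=\Big(\frac r{b+2}\Big)^{-\ell}f_{\ell k}(F_{b+k}q_n),\qquad q_\ell=\Big(\frac r{b+2}\Big)^{-\ell}f_{\ell k}(F_iq_n).$$ These quantities do not depend on the choice of $k$, $n$, $i$. Their initial values are $$a_0=\frac{b+1}{2+4b},\quad b_0=\frac b{2+4b},\quad p_0=\frac{b+1}{2b+1},\quad q_0=\frac b{2b+1},$$ and for every $j>0$ $$\frac{(b+2)^{j+1}(2b+1)^{j+1}}{b^j}\,a_j=\nu_1a_j+\nu_2b_j+(b+1)\sum_{\ell=0}^{j-1}(a_\ell+b_\ell)\big((b+1)p_{j-\ell}+b\,q_{j-\ell}\big),$$ $$\frac{(b+2)^{j+1}(2b+1)^{j+1}}{b^j}\,b_j=\upsilon_1a_j+\upsilon_2b_j+(b+1)\sum_{\ell=0}^{j-1}(a_\ell+b_\ell)\big(b\,p_{j-\ell}+(b+1)q_{j-\ell}\big),$$ where $$\nu_1=\frac{2b^3+8b^2+7b+2}{2b+1},\quad \nu_2=\frac{2b^3+6b^2+6b+2}{2b+1},\quad \upsilon_1=\frac{2b^3+4b^2+2b}{2b+1},\quad \upsilon_2=\frac{2b^3+6b^2+3b}{2b+1}.$$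 -/

import Mathlib

open Filter Topology MeasureTheory
open scoped ENNReal

namespace BubbleDiamond

/-! ## The graph approximations

The oriented edges of the graph `G_ℓ` (equivalently, its `ℓ`-cells) are indexed by the words of
length `ℓ` over the alphabet `Fin (b + 2)`.  Every edge `w` is replaced at the next level by two new
vertices `inner w 0` and `inner w 1`, one edge from each of them to the old end point of `w`
with the same index, and `b` parallel edges between them. -/

/-- The vertex set `V_*` (the union of all `V_ℓ`): the two boundary points `q₁ = bdry 0` and
`q₂ = bdry 1`, together with the two new vertices `inner w 0`, `inner w 1` introduced when the
edge `w` is subdivided.  The vertices `inner w k` with `w` of length `< ℓ` and the boundary points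
form `V_ℓ`. -/
inductive Vertex (b : ℕ) : Type
  | bdry (k : Fin 2) : Vertex b
  | inner (w : List (Fin (b + 2))) (k : Fin 2) : Vertex b

/-- The maps `F_i : V_* → V_*`.  The index `Fin.castAdd 2 i` with `i : Fin b` stands for the `b`
middle copies, joining the two new vertices of `G_1`; the index `Fin.natAdd b k` with `k : Fin 2`
stands for the copy that contains the boundary point `bdry k` (so these are `F_{b+1}`, `F_{b+2}`). -/
def F {b : ℕ} (i : Fin (b + 2)) : Vertex b → Vertex b
  | .bdry k => Fin.addCases (fun _ => .inner [] k)
      (fun m => if k = m then .bdry m else .inner [] m) i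
  | .inner w k => .inner (i :: w) k

/-- `F_w = F_{w₁} ∘ ⋯ ∘ F_{w_ℓ}` for a word `w`. -/
def applyWord {b : ℕ} (w : List (Fin (b + 2))) (p : Vertex b) : Vertex b := w.foldr F p

/-- The inductive construction of the graphs: the edge `w` of `G_ℓ`, with end points
`applyWord w (bdry 0)` and `applyWord w (bdry 1)`, is replaced by the edges `w ++ [i]` of `G_{ℓ+1}`:
`b` edges between the new vertices `inner w 0` and `inner w 1`, and an edge between
`inner w k` and the old end point number `k`, for both `k`. -/
theorem applyWord_append_bdry {b : ℕ} (w : List (Fin (b + 2))) (k : Fin 2) :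
    (∀ i : Fin b, applyWord (w ++ [Fin.castAdd 2 i]) (.bdry k) = .inner w k) ∧
    applyWord (w ++ [Fin.natAdd b k]) (.bdry k) = applyWord w (.bdry k) ∧
    (∀ n, n ≠ k → applyWord (w ++ [Fin.natAdd b k]) (.bdry n) = .inner w k) := by
  have h : ∀ (w : List (Fin (b + 2))) (m : Fin 2),
      applyWord w (Vertex.inner [] m) = Vertex.inner w m := by
    intro w m
    induction w with
    | nil => rfl
    | cons i w ih =>
      change F i (applyWord w (Vertex.inner [] m)) = _
      rw [ih]; rfl
  refine ⟨fun i => ?_, ?_, fun n hn => ?_⟩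
  · rw [← h w k]; simp [applyWord, F]
  · simp [applyWord, F]
  · rw [← h w k]; simp [applyWord, F, hn]

/-- The renormalization constant `r = b / (2b + 1)`. -/
noncomputable def renorm (b : ℕ) : ℝ := (b : ℝ) / (2 * b + 1)

/-- The graph energy `𝓔_ℓ(f) = r^{-ℓ} ∑_{p ∼ q} |f p - f q|²`, the sum being over the edges of `G_ℓ`
(parallel edges counted separately). -/
noncomputable def graphEnergy {b : ℕ} (ℓ : ℕ) (f : Vertex b → ℝ) : ℝ :=
  (renorm b)⁻¹ ^ ℓ * ∑ w : Fin ℓ → Fin (b + 2),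
    (f (applyWord (List.ofFn w) (.bdry 0)) - f (applyWord (List.ofFn w) (.bdry 1))) ^ 2

/-- The energy `𝓔(f) ∈ [0, ∞]` of a function on `V_*`: the limit of the nondecreasing sequence of its
graph energies (see `tendsto_graphEnergy`). -/
noncomputable def energy {b : ℕ} (f : Vertex b → ℝ) : ℝ≥0∞ :=
  ⨆ ℓ, ENNReal.ofReal (graphEnergy ℓ f)

theorem renorm_nonneg (b : ℕ) : 0 ≤ renorm b := by unfold renorm; positivity

theorem graphEnergy_nonneg {b : ℕ} (ℓ : ℕ) (f : Vertex b → ℝ) : 0 ≤ graphEnergy ℓ f := by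
  have := renorm_nonneg b
  unfold graphEnergy; positivity

theorem graphEnergy_zero {b : ℕ} (f : Vertex b → ℝ) :
    graphEnergy 0 f = (f (.bdry 0) - f (.bdry 1)) ^ 2 := by
  simp [graphEnergy, applyWord]

/-- Self-similarity of the graph energies. -/
theorem graphEnergy_succ {b : ℕ} (ℓ : ℕ) (f : Vertex b → ℝ) :
    graphEnergy (ℓ + 1) f = (renorm b)⁻¹ * ∑ i, graphEnergy ℓ (f ∘ F i) := by
  unfold graphEnergy
  rw [← Finset.mul_sum, pow_succ', mul_assoc]
  congr 2
  rw [← (Fin.consEquiv (fun _ => Fin (b + 2))).sum_comp, Fintype.sum_prod_type]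
  refine Finset.sum_congr rfl fun i _ => Finset.sum_congr rfl fun w _ => ?_
  simp [Fin.consEquiv, List.ofFn_succ, applyWord]

theorem graphEnergy_one {b : ℕ} (f : Vertex b → ℝ) :
    graphEnergy 1 f = (renorm b)⁻¹ * (b * (f (.inner [] 0) - f (.inner [] 1)) ^ 2 +
      ((f (.bdry 0) - f (.inner [] 0)) ^ 2 + (f (.inner [] 1) - f (.bdry 1)) ^ 2)) := by
  rw [graphEnergy_succ, Fin.sum_univ_add]
  simp [graphEnergy_zero, F, Fin.sum_univ_two]

theorem graphEnergy_mono {b : ℕ} (hb : 1 ≤ b) (f : Vertex b → ℝ) :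
    Monotone fun ℓ => graphEnergy ℓ f := by
  have h0 : ∀ f : Vertex b → ℝ, graphEnergy 0 f ≤ graphEnergy 1 f := by
    intro f
    rw [graphEnergy_zero, graphEnergy_one]
    have hb' : (0 : ℝ) < b := by exact_mod_cast hb
    have hr : (renorm b)⁻¹ = (2 * b + 1) / b := by rw [renorm, inv_div]
    rw [hr, div_mul_eq_mul_div, le_div_iff₀ hb']
    generalize f (.bdry 0) = x
    generalize f (.bdry 1) = y
    generalize f (.inner [] 0) = a
    generalize f (.inner [] 1) = c
    nlinarith [mul_nonneg hb'.le (sq_nonneg ((x - a) - (c - y))),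
      sq_nonneg ((x - a) - b * (a - c)), sq_nonneg ((c - y) - b * (a - c))]
  refine monotone_nat_of_le_succ fun ℓ => ?_
  induction ℓ generalizing f with
  | zero => exact h0 f
  | succ ℓ ih =>
    rw [graphEnergy_succ, graphEnergy_succ (ℓ + 1)]
    exact mul_le_mul_of_nonneg_left (Finset.sum_le_sum fun i _ => ih _)
      (inv_nonneg.2 (renorm_nonneg b))

theorem tendsto_graphEnergy {b : ℕ} (hb : 1 ≤ b) (f : Vertex b → ℝ) :
    Tendsto (fun ℓ => ENNReal.ofReal (graphEnergy ℓ f)) atTop (𝓝 (energy f)) :=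
  tendsto_atTop_iSup fun _ _ h => ENNReal.ofReal_le_ofReal (graphEnergy_mono hb f h)

/-- The bilinear form `𝓔(f, g)` obtained from `𝓔` by polarization, for `f` and `g` of finite
energy. -/
noncomputable def energyForm {b : ℕ} (f g : Vertex b → ℝ) : ℝ :=
  ((energy (f + g)).toReal - (energy (f - g)).toReal) / 4

/-! ## The resistance metric and the fractal -/

/-- The numbers `R ∈ [0, ∞]` with `|f p - f q|² ≤ R 𝓔(f)` for all `f` of finite energy. -/
def resistanceBounds {b : ℕ} (p q : Vertex b) : Set ℝ≥0∞ :=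
  {R | ∀ f : Vertex b → ℝ, energy f ≠ ⊤ → ENNReal.ofReal ((f p - f q) ^ 2) ≤ R * energy f}

/-- The resistance metric: the least `R` with `|f p - f q|² ≤ R 𝓔(f)` for all `f` of
finite energy. -/
noncomputable def resistance {b : ℕ} (p q : Vertex b) : ℝ≥0∞ := sInf (resistanceBounds p q)

theorem energy_min_add_energy_max_le {b : ℕ} (f : Vertex b → ℝ) (t : ℝ) :
    energy (fun p => min (f p) t) + energy (fun p => max (f p) t) ≤ energy f := by
  have key : ∀ ℓ, graphEnergy ℓ (fun p => min (f p) t) + graphEnergy ℓ (fun p => max (f p) t)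
      ≤ graphEnergy ℓ f := by
    intro ℓ
    unfold graphEnergy
    rw [← mul_add, ← Finset.sum_add_distrib]
    refine mul_le_mul_of_nonneg_left (Finset.sum_le_sum fun w _ => ?_)
      (pow_nonneg (inv_nonneg.2 (renorm_nonneg b)) _)
    beta_reduce
    generalize f (applyWord (List.ofFn w) (.bdry 0)) = x
    generalize f (applyWord (List.ofFn w) (.bdry 1)) = y
    rcases le_total x t with hx | hx <;> rcases le_total y t with hy | hy <;>
      simp only [min_eq_left, min_eq_right, max_eq_left, max_eq_right, hx, hy] <;>
      nlinarith [mul_nonneg (sub_nonneg.2 hx) (sub_nonneg.2 hy)]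
  unfold energy
  rw [ENNReal.iSup_add_iSup]
  · refine iSup_mono fun ℓ => ?_
    rw [← ENNReal.ofReal_add (graphEnergy_nonneg _ _) (graphEnergy_nonneg _ _)]
    exact ENNReal.ofReal_le_ofReal (key ℓ)
  · intro i j
    rcases Nat.eq_zero_or_pos b with rfl | hb
    · have h : ∀ (g : Vertex 0 → ℝ) (ℓ : ℕ), graphEnergy ℓ g ≤ graphEnergy 0 g := by
        intro g ℓ
        cases ℓ with
        | zero => exact le_rfl
        | succ ℓ => simpa [graphEnergy, renorm] using graphEnergy_nonneg 0 g
      exact ⟨0, add_le_add (ENNReal.ofReal_le_ofReal (h _ _)) (ENNReal.ofReal_le_ofReal (h _ _))⟩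
    · exact ⟨max i j, add_le_add
        (ENNReal.ofReal_le_ofReal (graphEnergy_mono hb _ (le_max_left i j)))
        (ENNReal.ofReal_le_ofReal (graphEnergy_mono hb _ (le_max_right i j)))⟩

theorem resistance_triangle {b : ℕ} (x y z : Vertex b) :
    resistance x z ≤ resistance x y + resistance y z := by
  unfold resistance
  rw [sInf_eq_iInf (s := resistanceBounds x y), sInf_eq_iInf (s := resistanceBounds y z)]
  simp only [ENNReal.iInf_add, ENNReal.add_iInf]
  refine le_iInf fun B => le_iInf fun hB => le_iInf fun A => le_iInf fun hA =>
    sInf_le fun f hf => ?_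
  -- it suffices to treat the case `f z ≤ f x`
  have key : ∀ (x y z : Vertex b) (A B : ℝ≥0∞), A ∈ resistanceBounds x y →
      B ∈ resistanceBounds y z → ∀ f : Vertex b → ℝ, energy f ≠ ⊤ → f z ≤ f x →
      ENNReal.ofReal ((f x - f z) ^ 2) ≤ (A + B) * energy f := by
    intro x y z A B hA hB f hf hxz
    rcases eq_or_ne (energy f) 0 with h0 | h0
    · have h1 := hA f hf
      have h2 := hB f hf
      rw [h0, mul_zero, nonpos_iff_eq_zero, ENNReal.ofReal_eq_zero] at h1 h2
      have h1' : f x - f y = 0 := pow_eq_zero_iff two_ne_zero |>.1 (le_antisymm h1 (sq_nonneg _))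
      have h2' : f y - f z = 0 := pow_eq_zero_iff two_ne_zero |>.1 (le_antisymm h2 (sq_nonneg _))
      have : f x - f z = 0 := by linarith
      simp [this]
    rcases eq_or_ne A ⊤ with rfl | hAt
    · simp [ENNReal.top_mul h0]
    rcases eq_or_ne B ⊤ with rfl | hBt
    · simp [ENNReal.top_mul h0]
    have hsum := energy_min_add_energy_max_le f (f y)
    set E₁ := energy (fun p => min (f p) (f y)) with hE₁
    set E₂ := energy (fun p => max (f p) (f y)) with hE₂
    have hE₁t : E₁ ≠ ⊤ := ne_top_of_le_ne_top hf (le_self_add.trans hsum)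
    have hE₂t : E₂ ≠ ⊤ := ne_top_of_le_ne_top hf (le_add_self.trans hsum)
    have h1 := hA _ hE₂t
    have h2 := hB _ hE₁t
    rw [← hE₂] at h1
    rw [← hE₁] at h2
    have e1 := ENNReal.toReal_mono (ENNReal.mul_ne_top hAt hE₂t) h1
    have e2 := ENNReal.toReal_mono (ENNReal.mul_ne_top hBt hE₁t) h2
    have e3 := ENNReal.toReal_mono hf hsum
    rw [ENNReal.toReal_ofReal (sq_nonneg _), ENNReal.toReal_mul] at e1 e2
    rw [ENNReal.toReal_add hE₁t hE₂t] at e3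
    rw [ENNReal.ofReal_le_iff_le_toReal (ENNReal.mul_ne_top (ENNReal.add_ne_top.2 ⟨hAt, hBt⟩) hf),
      ENNReal.toReal_mul, ENNReal.toReal_add hAt hBt]
    have a0 := ENNReal.toReal_nonneg (a := A)
    have b0 := ENNReal.toReal_nonneg (a := B)
    have c0 := ENNReal.toReal_nonneg (a := E₁)
    have d0 := ENNReal.toReal_nonneg (a := E₂)
    generalize ENNReal.toReal A = a at *
    generalize ENNReal.toReal B = b' at *
    generalize ENNReal.toReal E₁ = c at *
    generalize ENNReal.toReal E₂ = d at *
    generalize ENNReal.toReal (energy f) = e at *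
    -- `u` and `v` are the increments of the two truncations
    have main : ∀ u v : ℝ, u ^ 2 ≤ a * d → v ^ 2 ≤ b' * c → (u + v) ^ 2 ≤ (a + b') * e := by
      intro u v hu hv
      have hac : 0 ≤ a * c := mul_nonneg a0 c0
      have hbd : 0 ≤ b' * d := mul_nonneg b0 d0
      have huv : 2 * (u * v) ≤ a * c + b' * d := by
        have h4 : (u * v) ^ 2 ≤ (a * c) * (b' * d) := by
          have := mul_le_mul hu hv (sq_nonneg v) (mul_nonneg a0 d0)
          nlinarith
        have h5 : (2 * (u * v)) ^ 2 ≤ (a * c + b' * d) ^ 2 := by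
          nlinarith [sq_nonneg (a * c - b' * d)]
        exact (abs_le_of_sq_le_sq' h5 (add_nonneg hac hbd)).2
      have h6 : (a + b') * (c + d) ≤ (a + b') * e :=
        mul_le_mul_of_nonneg_left e3 (add_nonneg a0 b0)
      nlinarith
    have := main _ _ e1 e2
    simp only [max_self, min_self] at this
    refine le_trans ?_ this
    rcases le_total (f x) (f y) with h | h <;> rcases le_total (f y) (f z) with h' | h' <;>
      simp only [min_eq_left, min_eq_right, max_eq_left, max_eq_right, h, h'] <;>
      nlinarith
  rcases le_total (f z) (f x) with h | h
  · exact key x y z A B hA hB f hf h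
  · have hsymm : ∀ {p q : Vertex b} {R}, R ∈ resistanceBounds p q → R ∈ resistanceBounds q p := by
      intro p q R hR g hg
      rw [← neg_sub, neg_sq]
      exact hR g hg
    rw [← neg_sub, neg_sq, add_comm]
    exact key z y x B A (hsymm hB) (hsymm hA) f hf h

/-- `V_*` with the resistance metric. -/
noncomputable instance (b : ℕ) : PseudoEMetricSpace (Vertex b) where
  edist := resistance
  edist_self p := le_antisymm (sInf_le fun f _ => by simp) (zero_le)
  edist_comm p q := by
    unfold resistance resistanceBounds
    congr 1; ext R
    refine forall₂_congr fun f _ => ?_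
    rw [← neg_sub (f p), neg_sq]
  edist_triangle := resistance_triangle

/-- The bubble-diamond fractal `K_b`: the completion of `V_*` with respect to the resistance
metric. -/
abbrev Fractal (b : ℕ) : Type := UniformSpace.Completion (Vertex b)

noncomputable instance (b : ℕ) : MeasurableSpace (Fractal b) := borel _
instance (b : ℕ) : BorelSpace (Fractal b) := ⟨rfl⟩

theorem energy_comp_F_le {b : ℕ} (hb : 1 ≤ b) (i : Fin (b + 2)) (f : Vertex b → ℝ) :
    energy (f ∘ F i) ≤ ENNReal.ofReal (renorm b) * energy f := by
  have hr : 0 < renorm b := by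
    have : (0 : ℝ) < b := by exact_mod_cast hb
    unfold renorm; positivity
  refine iSup_le fun ℓ => ?_
  have h : graphEnergy ℓ (f ∘ F i) ≤ renorm b * graphEnergy (ℓ + 1) f := by
    rw [graphEnergy_succ, ← mul_assoc, mul_inv_cancel₀ hr.ne', one_mul]
    exact Finset.single_le_sum (f := fun i => graphEnergy ℓ (f ∘ F i))
      (fun j _ => graphEnergy_nonneg _ _) (Finset.mem_univ i)
  refine (ENNReal.ofReal_le_ofReal h).trans ?_
  rw [ENNReal.ofReal_mul hr.le]
  exact mul_le_mul_right (le_iSup (fun ℓ => ENNReal.ofReal (graphEnergy ℓ f)) (ℓ + 1)) _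

/-- The maps `F_i` contract the resistance metric by the factor `r`. -/
theorem edist_F_le {b : ℕ} (hb : 1 ≤ b) (i : Fin (b + 2)) (p q : Vertex b) :
    edist (F i p) (F i q) ≤ ENNReal.ofReal (renorm b) * edist p q := by
  have hr : 0 < renorm b := by
    have : (0 : ℝ) < b := by exact_mod_cast hb
    unfold renorm; positivity
  change sInf _ ≤ ENNReal.ofReal (renorm b) * sInf (resistanceBounds p q)
  rw [sInf_eq_iInf (s := resistanceBounds p q),
    ENNReal.mul_iInf_of_ne (by simpa using hr) ENNReal.ofReal_ne_top]
  refine le_iInf fun R => ?_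
  by_cases hR : R ∈ resistanceBounds p q
  · simp only [hR, iInf_pos]
    refine sInf_le fun f hf => ?_
    have h := energy_comp_F_le hb i f
    have h' := hR (f ∘ F i) (ne_top_of_le_ne_top (ENNReal.mul_ne_top ENNReal.ofReal_ne_top hf) h)
    refine h'.trans ((mul_le_mul_right h R).trans_eq ?_)
    ring
  · simp only [hR, iInf_false]
    rw [ENNReal.mul_top (by simpa using hr)]
    exact le_top

theorem lipschitzWith_F {b : ℕ} (hb : 1 ≤ b) (i : Fin (b + 2)) :
    LipschitzWith (renorm b).toNNReal (F i : Vertex b → Vertex b) :=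
  fun p q => edist_F_le hb i p q

/-- The continuous extension `F_i : K_b → K_b` of the map `F_i` of `V_*`. -/
noncomputable def FK {b : ℕ} (i : Fin (b + 2)) : Fractal b → Fractal b :=
  UniformSpace.Completion.map (F i)

theorem FK_coe {b : ℕ} (hb : 1 ≤ b) (i : Fin (b + 2)) (p : Vertex b) :
    FK i (p : Fractal b) = (F i p : Fractal b) :=
  UniformSpace.Completion.map_coe (lipschitzWith_F hb i).uniformContinuous p

theorem continuous_FK {b : ℕ} (i : Fin (b + 2)) : Continuous (FK i) :=
  UniformSpace.Completion.continuous_map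

/-! ## The self-similar measure -/

/-- The vertex `F_{ω₀} ∘ ⋯ ∘ F_{ω_{m-1}} (q₁)`. -/
def codeApprox {b : ℕ} (ω : ℕ → Fin (b + 2)) (m : ℕ) : Vertex b :=
  applyWord (List.ofFn fun j : Fin m => ω j) (.bdry 0)

/-- The point of `K_b` with address `ω`, the limit of `F_{ω₀} ∘ ⋯ ∘ F_{ω_{m-1}} (q₁)`. -/
noncomputable def code {b : ℕ} (ω : ℕ → Fin (b + 2)) : Fractal b :=
  haveI : Nonempty (Fractal b) := ⟨((Vertex.bdry 0 : Vertex b) : Fractal b)⟩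
  limUnder atTop fun m => (codeApprox ω m : Fractal b)

/-- The self-similar probability measure `μ` on `K_b`: the image under the address map of the
measure on infinite words whose letters are independent and uniformly distributed.  It is
characterized by `selfSimilarMeasure_apply`. -/
noncomputable def selfSimilarMeasure (b : ℕ) : Measure (Fractal b) :=
  (Measure.infinitePi fun _ : ℕ => (PMF.uniformOfFintype (Fin (b + 2))).toMeasure).map code

theorem edist_applyWord_le {b : ℕ} (hb : 1 ≤ b) (w : List (Fin (b + 2))) (p q : Vertex b) :
    edist (applyWord w p) (applyWord w q) ≤
      ENNReal.ofReal (renorm b) ^ w.length * edist p q := by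
  induction w with
  | nil => simp [applyWord]
  | cons i w ih =>
    refine (edist_F_le hb i _ _).trans ?_
    rw [List.length_cons, pow_succ', mul_assoc]
    exact mul_le_mul_right ih _

theorem edist_bdry_le {b : ℕ} : edist (Vertex.bdry 0 : Vertex b) (.bdry 1) ≤ 1 := by
  refine sInf_le fun f _ => ?_
  rw [one_mul, ← graphEnergy_zero]
  exact le_iSup (fun ℓ => ENNReal.ofReal (graphEnergy ℓ f)) 0

theorem renorm_le_half {b : ℕ} : renorm b ≤ 1 / 2 := by
  unfold renorm
  rw [div_le_div_iff₀ (by positivity) (by norm_num)]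
  linarith

theorem ofReal_renorm_lt_one {b : ℕ} : ENNReal.ofReal (renorm b) < 1 := by
  rw [ENNReal.ofReal_lt_one]
  linarith [renorm_le_half (b := b)]

theorem edist_bdry_F_le {b : ℕ} (hb : 1 ≤ b) (i : Fin (b + 2)) :
    edist (Vertex.bdry 0 : Vertex b) (F i (.bdry 0)) ≤ 2 := by
  have h : ∀ i : Fin (b + 2), edist (F i (Vertex.bdry 0 : Vertex b)) (F i (.bdry 1)) ≤ 1 := by
    intro i
    refine (edist_F_le hb i _ _).trans ?_
    calc _ ≤ (1 : ℝ≥0∞) * 1 := mul_le_mul' ofReal_renorm_lt_one.le edist_bdry_le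
      _ = 1 := one_mul 1
  have h1 : edist (Vertex.bdry 0 : Vertex b) (.inner [] 0) ≤ 1 := by
    simpa [F] using h (Fin.natAdd b 0)
  have h2 : edist (Vertex.inner [] 0 : Vertex b) (.inner [] 1) ≤ 1 := by
    have := h (Fin.castAdd 2 ⟨0, hb⟩)
    simpa only [F, Fin.addCases_left] using this
  induction i using Fin.addCases with
  | left i =>
    simp only [F, Fin.addCases_left]
    exact h1.trans (by norm_num)
  | right m =>
    simp only [F, Fin.addCases_right]
    split_ifs with hm
    · rw [← hm]; simp
    · obtain rfl : m = 1 := by omega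
      exact (edist_triangle _ (Vertex.inner [] 0) _).trans
        ((add_le_add h1 h2).trans_eq one_add_one_eq_two)

theorem edist_codeApprox_le {b : ℕ} (hb : 1 ≤ b) (ω : ℕ → Fin (b + 2)) (m : ℕ) :
    edist (codeApprox ω m) (codeApprox ω (m + 1)) ≤ 2 * ENNReal.ofReal (renorm b) ^ m := by
  have h : codeApprox ω (m + 1) =
      applyWord (List.ofFn fun j : Fin m => ω j) (F (ω m) (.bdry 0)) := by
    unfold codeApprox applyWord
    rw [List.ofFn_succ', List.concat_eq_append, List.foldr_append]
    simp
  rw [h, mul_comm]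
  refine (edist_applyWord_le hb _ _ _).trans ?_
  rw [List.length_ofFn]
  exact mul_le_mul_right (edist_bdry_F_le hb _) _

theorem tendsto_code {b : ℕ} (hb : 1 ≤ b) (ω : ℕ → Fin (b + 2)) :
    Tendsto (fun m => (codeApprox ω m : Fractal b)) atTop (𝓝 (code ω)) := by
  have h : CauchySeq (codeApprox ω) :=
    cauchySeq_of_edist_le_geometric _ _ ofReal_renorm_lt_one (by norm_num)
      (edist_codeApprox_le hb ω)
  have h' : CauchySeq fun m => (codeApprox ω m : Fractal b) :=
    h.map (UniformSpace.Completion.uniformContinuous_coe _)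
  exact CauchySeq.tendsto_limUnder h'

theorem edist_codeApprox_add_le {b : ℕ} (hb : 1 ≤ b) (ω : ℕ → Fin (b + 2)) (k m : ℕ) :
    edist (codeApprox ω m) (codeApprox ω (m + k)) ≤ 4 * ENNReal.ofReal (renorm b) ^ m := by
  induction k generalizing m with
  | zero => simp
  | succ k ih =>
    have h1 := edist_codeApprox_le hb ω m
    have h2 := ih (m + 1)
    rw [show m + 1 + k = m + (k + 1) by ring] at h2
    have h3 : 4 * ENNReal.ofReal (renorm b) ≤ 2 := by
      calc 4 * ENNReal.ofReal (renorm b) ≤ ENNReal.ofReal 4 * ENNReal.ofReal (1 / 2) := by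
            gcongr
            · simp
            · exact renorm_le_half
        _ = 2 := by
            rw [← ENNReal.ofReal_mul (by norm_num)]; norm_num
    calc edist (codeApprox ω m) (codeApprox ω (m + (k + 1)))
        ≤ 2 * ENNReal.ofReal (renorm b) ^ m + 4 * ENNReal.ofReal (renorm b) ^ (m + 1) :=
          (edist_triangle _ _ _).trans (add_le_add h1 h2)
      _ = (2 + 4 * ENNReal.ofReal (renorm b)) * ENNReal.ofReal (renorm b) ^ m := by ring
      _ ≤ (2 + 2) * ENNReal.ofReal (renorm b) ^ m := by gcongr
      _ = 4 * ENNReal.ofReal (renorm b) ^ m := by norm_num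

theorem continuous_code {b : ℕ} (hb : 1 ≤ b) : Continuous (code (b := b)) := by
  have hloc : ∀ m, Continuous fun ω : ℕ → Fin (b + 2) => (codeApprox ω m : Fractal b) := by
    intro m
    have : (fun ω : ℕ → Fin (b + 2) => (codeApprox ω m : Fractal b)) =
        (fun v : Fin m → Fin (b + 2) => ((applyWord (List.ofFn v) (.bdry 0) : Vertex b) :
          Fractal b)) ∘ fun ω j => ω j := rfl
    rw [this]
    exact continuous_of_discreteTopology.comp (by fun_prop)
  have hcau : UniformCauchySeqOn (fun m (ω : ℕ → Fin (b + 2)) => codeApprox ω m) atTop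
      Set.univ := by
    intro u hu
    obtain ⟨ε, hε, hu⟩ := mem_uniformity_edist.1 hu
    have hlim : Tendsto (fun m => 4 * ENNReal.ofReal (renorm b) ^ m) atTop (𝓝 0) := by
      simpa using ENNReal.Tendsto.const_mul
        (ENNReal.tendsto_pow_atTop_nhds_zero_of_lt_one (ofReal_renorm_lt_one (b := b)))
        (Or.inr (by norm_num : (4 : ℝ≥0∞) ≠ ⊤))
    obtain ⟨N, hN⟩ := (hlim.eventually_lt_const hε).exists_forall_of_atTop
    have hle : ∀ ω : ℕ → Fin (b + 2), ∀ m n, N ≤ m → m ≤ n →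
        edist (codeApprox ω m) (codeApprox ω n) < ε := by
      intro ω m n hm hmn
      obtain ⟨k, rfl⟩ := Nat.exists_eq_add_of_le hmn
      exact (edist_codeApprox_add_le hb ω k m).trans_lt (hN m hm)
    filter_upwards [(eventually_ge_atTop N).prod_mk (eventually_ge_atTop N)] with mn h ω _
    refine hu ?_
    rcases le_total mn.1 mn.2 with h' | h'
    · exact hle ω _ _ h.1 h'
    · rw [edist_comm]; exact hle ω _ _ h.2 h'
  have hunif := ((UniformSpace.Completion.uniformContinuous_coe _).comp_uniformCauchySeqOn
    hcau).tendstoUniformlyOn_of_tendsto fun ω _ => tendsto_code hb ω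
  rw [tendstoUniformlyOn_univ] at hunif
  exact hunif.continuous (Frequently.of_forall hloc)

/-- Prepending a letter to an infinite word. -/
def consWord {b : ℕ} (i : Fin (b + 2)) (ω : ℕ → Fin (b + 2)) : ℕ → Fin (b + 2)
  | 0 => i
  | n + 1 => ω n

theorem measurable_consWord {b : ℕ} (i : Fin (b + 2)) : Measurable (consWord i) := by
  refine measurable_pi_lambda _ fun n => ?_
  cases n with
  | zero => exact measurable_const
  | succ n => exact measurable_pi_apply n

theorem code_consWord {b : ℕ} (hb : 1 ≤ b) (i : Fin (b + 2)) (ω : ℕ → Fin (b + 2)) :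
    code (consWord i ω) = FK i (code ω) := by
  refine tendsto_nhds_unique ((tendsto_code hb (consWord i ω)).comp (tendsto_add_atTop_nat 1)) ?_
  have h := ((continuous_FK i).tendsto _).comp (tendsto_code hb ω)
  refine h.congr fun m => ?_
  simp only [Function.comp_apply]
  rw [FK_coe hb]
  simp [codeApprox, List.ofFn_succ, applyWord, consWord]

theorem uniform_apply {b : ℕ} (S : Set (Fin (b + 2))) :
    (PMF.uniformOfFintype (Fin (b + 2))).toMeasure S =
      ((b : ℝ≥0∞) + 2)⁻¹ * ∑ i, S.indicator 1 i := by
  rw [PMF.toMeasure_apply_fintype _ _, Finset.mul_sum]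
  refine Finset.sum_congr rfl fun i _ => ?_
  by_cases hi : i ∈ S <;> simp [hi]

theorem infinitePi_eq_sum {b : ℕ} :
    (Measure.infinitePi fun _ : ℕ => (PMF.uniformOfFintype (Fin (b + 2))).toMeasure) =
      ((b : ℝ≥0∞) + 2)⁻¹ • ∑ i, (Measure.infinitePi fun _ : ℕ =>
        (PMF.uniformOfFintype (Fin (b + 2))).toMeasure).map (consWord i) := by
  symm
  refine Measure.eq_infinitePi _ fun s t ht => ?_
  set P := Measure.infinitePi fun _ : ℕ => (PMF.uniformOfFintype (Fin (b + 2))).toMeasure with hP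
  set s' : Finset ℕ := s.preimage Nat.succ (Nat.succ_injective.injOn) with hs'
  have hcons : ∀ i : Fin (b + 2), P.map (consWord i) (Set.pi s t) =
      (if 0 ∈ s then (t 0).indicator 1 i else 1) *
        ∏ n ∈ s', (PMF.uniformOfFintype (Fin (b + 2))).toMeasure (t (n + 1)) := by
    intro i
    rw [Measure.map_apply (measurable_consWord i)
      (MeasurableSet.pi s.countable_toSet fun j _ => MeasurableSet.of_discrete),
      ← Measure.infinitePi_pi (μ := fun _ : ℕ => (PMF.uniformOfFintype (Fin (b + 2))).toMeasure)
        (s := s') (t := fun n => t (n + 1)) (fun _ _ => MeasurableSet.of_discrete), ← hP]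
    by_cases hc : 0 ∈ s → i ∈ t 0
    · have h1 : consWord i ⁻¹' Set.pi s t = Set.pi s' fun n => t (n + 1) := by
        ext ω
        simp only [Set.mem_preimage, Set.mem_pi, Finset.mem_coe, hs', Finset.mem_preimage]
        constructor
        · intro h n hn
          exact h (n + 1) hn
        · intro h n hn
          cases n with
          | zero => exact hc hn
          | succ n => exact h n hn
      rw [h1]
      by_cases h0 : 0 ∈ s
      · simp [h0, hc h0]
      · simp [h0]
    · push Not at hc
      have h1 : consWord i ⁻¹' Set.pi s t = ∅ := by
        ext ω
        simp only [Set.mem_preimage, Set.mem_pi, Set.mem_empty_iff_false, iff_false]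
        intro h
        exact hc.2 (h 0 hc.1)
      rw [h1]
      simp [hc.1, hc.2]
  rw [Measure.smul_apply, Measure.finsetSum_apply, Finset.sum_congr rfl fun i _ => hcons i,
    ← Finset.sum_mul, smul_eq_mul, ← mul_assoc]
  have hprod : ∀ g : ℕ → ℝ≥0∞, ∏ n ∈ s, g n = (if 0 ∈ s then g 0 else 1) *
      ∏ n ∈ s', g (n + 1) := by
    intro g
    have himg : (s'.image Nat.succ) = s.erase 0 := by
      ext n
      cases n <;> simp [hs']
    have h2 : ∏ n ∈ s', g (n + 1) = ∏ n ∈ s.erase 0, g n := by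
      rw [← himg, Finset.prod_image (Nat.succ_injective.injOn)]
    rw [h2]
    split_ifs with h0
    · rw [Finset.mul_prod_erase _ _ h0]
    · rw [one_mul, Finset.erase_eq_of_notMem h0]
  rw [hprod]
  congr 1
  split_ifs with h0
  · rw [uniform_apply]
  · simp only [Finset.sum_const, Finset.card_univ, Fintype.card_fin, nsmul_eq_mul, mul_one]
    push_cast
    exact ENNReal.inv_mul_cancel (by simp) (by simp)

theorem isProbabilityMeasure_selfSimilarMeasure {b : ℕ} (hb : 1 ≤ b) :
    IsProbabilityMeasure (selfSimilarMeasure b) :=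
  Measure.isProbabilityMeasure_map (continuous_code hb).measurable.aemeasurable

/-- The self-similarity `μ(A) = (b + 2)⁻¹ ∑ μ(F_i⁻¹ A)`. -/
theorem selfSimilarMeasure_apply {b : ℕ} (hb : 1 ≤ b) {A : Set (Fractal b)}
    (hA : MeasurableSet A) :
    selfSimilarMeasure b A =
      ((b : ℝ≥0∞) + 2)⁻¹ * ∑ i, selfSimilarMeasure b (FK i ⁻¹' A) := by
  have hm : Measurable (code (b := b)) := (continuous_code hb).measurable
  have hS := hm hA
  unfold selfSimilarMeasure
  rw [Measure.map_apply hm hA]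
  conv_lhs => rw [infinitePi_eq_sum]
  rw [Measure.smul_apply, Measure.finsetSum_apply, smul_eq_mul]
  congr 1
  refine Finset.sum_congr rfl fun i _ => ?_
  rw [Measure.map_apply (measurable_consWord i) hS,
    Measure.map_apply hm ((continuous_FK i).measurable hA)]
  congr 1
  ext ω
  simp [code_consWord hb]

/-! ## The Laplacian and the multiharmonic basis functions -/

/-- The restriction to `V_*` of a function on `K_b`. -/
noncomputable def onVertices {b : ℕ} (u : C(Fractal b, ℝ)) : Vertex b → ℝ := fun p => u (p : Fractal b)

/-- `u ∈ dom 𝓔`.  Every function of finite energy on `V_*` is uniformly continuous for the resistance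
metric, so functions in `dom 𝓔` are the same as continuous functions on `K_b` whose restriction to
`V_*` has finite energy. -/
def InDomEnergy {b : ℕ} (u : C(Fractal b, ℝ)) : Prop := energy (onVertices u) ≠ ⊤

/-- `u ∈ dom Δ` and `Δ u = f`. -/
def IsLaplacian {b : ℕ} (u f : C(Fractal b, ℝ)) : Prop :=
  InDomEnergy u ∧ ∀ g : C(Fractal b, ℝ), InDomEnergy g →
    (∀ k : Fin 2, onVertices g (.bdry k) = 0) →
    energyForm (onVertices u) (onVertices g) = -∫ x, f x * g x ∂(selfSimilarMeasure b)

/-- `u` solves `Δ^{j+1} u = 0` with the boundary conditions `Δ^m u (q_n) = δ_{jm} δ_{kn}`.  The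
sequence `v` lists the iterated Laplacians `v m = Δ^m u`. -/
def IsMultiharmonicBasis {b : ℕ} (j : ℕ) (k : Fin 2) (u : C(Fractal b, ℝ)) : Prop :=
  ∃ v : ℕ → C(Fractal b, ℝ), v 0 = u ∧ (∀ m ≤ j, IsLaplacian (v m) (v (m + 1))) ∧
    v (j + 1) = 0 ∧
    ∀ m ≤ j, ∀ n : Fin 2, onVertices (v m) (.bdry n) = if m = j ∧ n = k then 1 else 0

/-- The inner product `∫ u v dμ` over `K_b`. -/
noncomputable def innerProd {b : ℕ} (u v : C(Fractal b, ℝ)) : ℝ :=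
  ∫ x, u x * v x ∂(selfSimilarMeasure b)

end BubbleDiamond

namespace BubbleDiamond

/-! ## The energy form -/

/-! Both recursions come from cutting $\int f_{jk}f_{0n}\,d\mu$ into the $b+2$ cells and
re-expanding each factor there in the same basis. Write $\lambda = r/(b+2)$, which is
`laplaceScale`.

The engine is the scaling law `IsLaplacian.compF`: if $\Delta u = f$ then $\Delta(u\circ F_i) =
\lambda\, f\circ F_i$. It holds because a test function on a cell can be extended by zero, which
multiplies energies by $r^{-1}$ and integrals by $1/(b+2)$. Together with uniqueness in the
Dirichlet problem it gives, by induction on $j$, $f_{jk}\circ F_i = \sum_{\ell\le j}\sum_m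
\lambda^\ell f_{j-\ell,k}(F_iq_m)\, f_{\ell m}$ (`compF_basis`): both sides have the same Laplacian
and the same boundary values. For $j=0$ only the harmonic part is left, so in $I(jk,0n)$ the second
factor contributes only the functions $f_{0m'}$, and every term carries the common factor
$\lambda^j$ (`innerProd_basis_recursion`).

The reflection exchanging $q_1$ and $q_2$ preserves the energy and $\mu$, hence takes $f_{jk}$ to
the basis function of the other boundary point. So all inner products $I(\ell m,0m')$ reduce to
$a_\ell, b_\ell$, and all values at the vertices of $G_1$ other than $q_1,q_2$ to $p_d, q_d$.
Summing over cells is then finite algebra; the terms $\ell=j$ give $\nu_i,\upsilon_i$. At $j=0$ the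
relation is homogeneous in $a_0,b_0$, and $a_0+b_0=\frac12$, which follows from $f_{01}+f_{02}=1$
and symmetry, fixes the scale.

Existence of the $f_{jk}$ rests on two facts: explicit harmonic functions, and Riesz representation
in the Hilbert space of finite-energy functions vanishing at $q_1,q_2$. -/

theorem graphEnergy_le_energy {b : ℕ} {f : Vertex b → ℝ} (hf : energy f ≠ ⊤) (ℓ : ℕ) :
    graphEnergy ℓ f ≤ (energy f).toReal :=
  (ENNReal.ofReal_le_iff_le_toReal hf).1 (le_iSup (fun ℓ => ENNReal.ofReal (graphEnergy ℓ f)) ℓ)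

theorem energy_le_ofReal {b : ℕ} {f : Vertex b → ℝ} {C : ℝ} (h : ∀ ℓ, graphEnergy ℓ f ≤ C) :
    energy f ≤ ENNReal.ofReal C :=
  iSup_le fun ℓ => ENNReal.ofReal_le_ofReal (h ℓ)

theorem energy_ne_top_of_le {b : ℕ} {f : Vertex b → ℝ} {C : ℝ} (h : ∀ ℓ, graphEnergy ℓ f ≤ C) :
    energy f ≠ ⊤ :=
  ne_top_of_le_ne_top ENNReal.ofReal_ne_top (energy_le_ofReal h)

/-- The bilinear form of the graph energy. -/
noncomputable def graphForm {b : ℕ} (ℓ : ℕ) (f g : Vertex b → ℝ) : ℝ :=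
  (renorm b)⁻¹ ^ ℓ * ∑ w : Fin ℓ → Fin (b + 2),
    (f (applyWord (List.ofFn w) (.bdry 0)) - f (applyWord (List.ofFn w) (.bdry 1))) *
      (g (applyWord (List.ofFn w) (.bdry 0)) - g (applyWord (List.ofFn w) (.bdry 1)))

theorem graphForm_self {b : ℕ} (ℓ : ℕ) (f : Vertex b → ℝ) : graphForm ℓ f f = graphEnergy ℓ f := by
  simp [graphForm, graphEnergy, sq]

theorem graphForm_comm {b : ℕ} (ℓ : ℕ) (f g : Vertex b → ℝ) :
    graphForm ℓ f g = graphForm ℓ g f := by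
  simp only [graphForm, mul_comm]

theorem graphForm_add_left {b : ℕ} (ℓ : ℕ) (f f' g : Vertex b → ℝ) :
    graphForm ℓ (f + f') g = graphForm ℓ f g + graphForm ℓ f' g := by
  simp only [graphForm, ← mul_add, ← Finset.sum_add_distrib, Pi.add_apply]
  congr 1
  exact Finset.sum_congr rfl fun w _ => by ring

theorem graphForm_smul_left {b : ℕ} (ℓ : ℕ) (c : ℝ) (f g : Vertex b → ℝ) :
    graphForm ℓ (c • f) g = c * graphForm ℓ f g := by
  simp only [graphForm, mul_left_comm c, Finset.mul_sum, Pi.smul_apply, smul_eq_mul]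
  exact Finset.sum_congr rfl fun w _ => by ring

theorem graphEnergy_add {b : ℕ} (ℓ : ℕ) (f g : Vertex b → ℝ) :
    graphEnergy ℓ (f + g) = graphEnergy ℓ f + 2 * graphForm ℓ f g + graphEnergy ℓ g := by
  simp only [← graphForm_self, graphForm_add_left]
  rw [graphForm_comm ℓ f, graphForm_comm ℓ g, graphForm_add_left, graphForm_add_left,
    graphForm_comm ℓ g f]
  ring

theorem graphEnergy_smul {b : ℕ} (ℓ : ℕ) (c : ℝ) (f : Vertex b → ℝ) :
    graphEnergy ℓ (c • f) = c ^ 2 * graphEnergy ℓ f := by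
  rw [← graphForm_self, graphForm_smul_left, graphForm_comm, graphForm_smul_left, graphForm_self]
  ring

theorem graphEnergy_sub {b : ℕ} (ℓ : ℕ) (f g : Vertex b → ℝ) :
    graphEnergy ℓ (f - g) = graphEnergy ℓ f - 2 * graphForm ℓ f g + graphEnergy ℓ g := by
  rw [show f - g = f + (-1 : ℝ) • g by ext; simp [sub_eq_add_neg], graphEnergy_add,
    graphEnergy_smul, graphForm_comm, graphForm_smul_left, graphForm_comm]
  ring

theorem graphForm_eq {b : ℕ} (ℓ : ℕ) (f g : Vertex b → ℝ) :
    graphForm ℓ f g = (graphEnergy ℓ (f + g) - graphEnergy ℓ (f - g)) / 4 := by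
  rw [graphEnergy_add, graphEnergy_sub]; ring

theorem graphForm_zero {b : ℕ} (f g : Vertex b → ℝ) :
    graphForm 0 f g = (f (.bdry 0) - f (.bdry 1)) * (g (.bdry 0) - g (.bdry 1)) := by
  simp [graphForm, applyWord]

theorem graphForm_succ {b : ℕ} (ℓ : ℕ) (f g : Vertex b → ℝ) :
    graphForm (ℓ + 1) f g = (renorm b)⁻¹ * ∑ i, graphForm ℓ (f ∘ F i) (g ∘ F i) := by
  simp only [graphForm_eq, graphEnergy_succ, ← Finset.sum_div, Finset.sum_sub_distrib]
  change _ = (renorm b)⁻¹ * ((∑ i, graphEnergy ℓ ((f + g) ∘ F i) -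
    ∑ i, graphEnergy ℓ ((f - g) ∘ F i)) / 4)
  ring

theorem energy_add_ne_top {b : ℕ} {f g : Vertex b → ℝ} (hf : energy f ≠ ⊤) (hg : energy g ≠ ⊤) :
    energy (f + g) ≠ ⊤ := by
  refine energy_ne_top_of_le (C := 2 * (energy f).toReal + 2 * (energy g).toReal) fun ℓ => ?_
  have h1 := graphEnergy_add ℓ f g
  have h2 := graphEnergy_sub ℓ f g
  have h3 := graphEnergy_nonneg ℓ (f - g)
  linarith [graphEnergy_le_energy hf ℓ, graphEnergy_le_energy hg ℓ]

theorem energy_smul_ne_top {b : ℕ} {f : Vertex b → ℝ} (c : ℝ) (hf : energy f ≠ ⊤) :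
    energy (c • f) ≠ ⊤ := by
  refine energy_ne_top_of_le (C := c ^ 2 * (energy f).toReal) fun ℓ => ?_
  rw [graphEnergy_smul]
  exact mul_le_mul_of_nonneg_left (graphEnergy_le_energy hf ℓ) (sq_nonneg c)

theorem energy_sub_ne_top {b : ℕ} {f g : Vertex b → ℝ} (hf : energy f ≠ ⊤) (hg : energy g ≠ ⊤) :
    energy (f - g) ≠ ⊤ := by
  rw [show f - g = f + (-1 : ℝ) • g by ext; simp [sub_eq_add_neg]]
  exact energy_add_ne_top hf (energy_smul_ne_top _ hg)

theorem energy_zero {b : ℕ} : energy (0 : Vertex b → ℝ) = 0 := by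
  simp [energy, graphEnergy]

theorem energy_comp_F_ne_top {b : ℕ} (hb : 1 ≤ b) (i : Fin (b + 2)) {f : Vertex b → ℝ}
    (hf : energy f ≠ ⊤) : energy (f ∘ F i) ≠ ⊤ :=
  ne_top_of_le_ne_top (ENNReal.mul_ne_top ENNReal.ofReal_ne_top hf) (energy_comp_F_le hb i f)

theorem tendsto_graphEnergy_toReal {b : ℕ} (hb : 1 ≤ b) {f : Vertex b → ℝ} (hf : energy f ≠ ⊤) :
    Tendsto (fun ℓ => graphEnergy ℓ f) atTop (𝓝 (energy f).toReal) := by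
  refine ((ENNReal.tendsto_toReal hf).comp (tendsto_graphEnergy hb f)).congr fun ℓ => ?_
  simp [ENNReal.toReal_ofReal (graphEnergy_nonneg ℓ f)]

/-- Since `energyForm` is defined by polarizing a supremum, its algebraic properties are not formal.
They are inherited from the bilinear forms on the graphs through this limit. -/
theorem tendsto_graphForm {b : ℕ} (hb : 1 ≤ b) {f g : Vertex b → ℝ} (hf : energy f ≠ ⊤)
    (hg : energy g ≠ ⊤) : Tendsto (fun ℓ => graphForm ℓ f g) atTop (𝓝 (energyForm f g)) := by
  simp only [graphForm_eq]
  exact ((tendsto_graphEnergy_toReal hb (energy_add_ne_top hf hg)).sub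
    (tendsto_graphEnergy_toReal hb (energy_sub_ne_top hf hg))).div_const 4

theorem energyForm_self {b : ℕ} (hb : 1 ≤ b) {f : Vertex b → ℝ} (hf : energy f ≠ ⊤) :
    energyForm f f = (energy f).toReal :=
  tendsto_nhds_unique (tendsto_graphForm hb hf hf) <| by
    simpa only [graphForm_self] using tendsto_graphEnergy_toReal hb hf

theorem energyForm_comm {b : ℕ} (hb : 1 ≤ b) {f g : Vertex b → ℝ} (hf : energy f ≠ ⊤)
    (hg : energy g ≠ ⊤) : energyForm f g = energyForm g f :=
  tendsto_nhds_unique (tendsto_graphForm hb hf hg) <| by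
    simpa only [graphForm_comm _ f g] using tendsto_graphForm hb hg hf

theorem energyForm_add_left {b : ℕ} (hb : 1 ≤ b) {f f' g : Vertex b → ℝ} (hf : energy f ≠ ⊤)
    (hf' : energy f' ≠ ⊤) (hg : energy g ≠ ⊤) :
    energyForm (f + f') g = energyForm f g + energyForm f' g :=
  tendsto_nhds_unique (tendsto_graphForm hb (energy_add_ne_top hf hf') hg) <| by
    simpa only [graphForm_add_left] using
      (tendsto_graphForm hb hf hg).add (tendsto_graphForm hb hf' hg)

theorem energyForm_smul_left {b : ℕ} (hb : 1 ≤ b) (c : ℝ) {f g : Vertex b → ℝ}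
    (hf : energy f ≠ ⊤) (hg : energy g ≠ ⊤) : energyForm (c • f) g = c * energyForm f g :=
  tendsto_nhds_unique (tendsto_graphForm hb (energy_smul_ne_top c hf) hg) <| by
    simpa only [graphForm_smul_left] using (tendsto_graphForm hb hf hg).const_mul c

/-! ## Continuity of functions of finite energy -/

theorem exists_codeApprox_eq {b : ℕ} (w : List (Fin (b + 2))) :
    ∃ ω m, codeApprox ω m = applyWord w (.bdry 0) := by
  -- The finite word is padded to an infinite one by the letter 0.
  refine ⟨fun j => w.getD j 0, w.length, ?_⟩
  unfold codeApprox
  congr 1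
  refine List.ext_getElem (by simp) fun n h1 h2 => ?_
  simp

/-- Every vertex except $q_2$ is the image of $q_1$ under some word, so the geometric-series bound
for address approximations, started at level 0, applies. -/
theorem edist_bdry_zero_le {b : ℕ} (hb : 1 ≤ b) (p : Vertex b) :
    edist (Vertex.bdry 0 : Vertex b) p ≤ 4 := by
  have key : ∀ w : List (Fin (b + 2)),
      edist (Vertex.bdry 0 : Vertex b) (applyWord w (.bdry 0)) ≤ 4 := by
    intro w
    obtain ⟨ω, m, h⟩ := exists_codeApprox_eq w
    have := edist_codeApprox_add_le hb ω m 0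
    rwa [zero_add, h, pow_zero, mul_one] at this
  match p with
  | .bdry 0 => simp
  | .bdry 1 => exact edist_bdry_le.trans (by norm_num)
  | .inner w 0 =>
    rw [← (applyWord_append_bdry w 0).1 ⟨0, hb⟩]
    exact key _
  | .inner w 1 =>
    rw [← (applyWord_append_bdry w 1).2.2 0 (by decide)]
    exact key _

theorem edist_vertex_ne_top {b : ℕ} (hb : 1 ≤ b) (p q : Vertex b) : edist p q ≠ ⊤ := by
  refine ne_top_of_le_ne_top ?_ (edist_triangle p (.bdry 0) q)
  rw [edist_comm]
  exact ENNReal.add_ne_top.2 ⟨ne_top_of_le_ne_top (by norm_num) (edist_bdry_zero_le hb p),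
    ne_top_of_le_ne_top (by norm_num) (edist_bdry_zero_le hb q)⟩

/-- The infimum defining the resistance is itself an admissible bound. Zero energy is treated apart,
where a single admissible bound suffices; one exists because the infimum of the empty set would be
`⊤`. -/
theorem ofReal_sq_sub_le {b : ℕ} (hb : 1 ≤ b) {f : Vertex b → ℝ} (hf : energy f ≠ ⊤)
    (p q : Vertex b) : ENNReal.ofReal ((f p - f q) ^ 2) ≤ edist p q * energy f := by
  have hpq : sInf (resistanceBounds p q) ≠ ⊤ := edist_vertex_ne_top hb p q
  change _ ≤ sInf (resistanceBounds p q) * energy f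
  rcases eq_or_ne (energy f) 0 with h0 | h0
  · obtain ⟨R, hR⟩ : (resistanceBounds p q).Nonempty := by
      rw [Set.nonempty_iff_ne_empty]
      intro h
      simp [h] at hpq
    simpa [h0] using hR f hf
  rw [sInf_eq_iInf, ENNReal.iInf_mul_of_ne h0 hf]
  refine le_iInf fun R => ?_
  by_cases hR : R ∈ resistanceBounds p q
  · simpa [hR] using hR f hf
  · simp [hR, ENNReal.top_mul h0]

theorem sq_sub_le {b : ℕ} (hb : 1 ≤ b) {f : Vertex b → ℝ} (hf : energy f ≠ ⊤) (p q : Vertex b) :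
    (f p - f q) ^ 2 ≤ (edist p q).toReal * (energy f).toReal := by
  rw [← ENNReal.toReal_mul]
  exact (ENNReal.ofReal_le_iff_le_toReal (ENNReal.mul_ne_top (edist_vertex_ne_top hb p q) hf)).1
    (ofReal_sq_sub_le hb hf p q)

theorem sq_sub_bdry_zero_le {b : ℕ} (hb : 1 ≤ b) {f : Vertex b → ℝ} (hf : energy f ≠ ⊤)
    (p : Vertex b) : (f (.bdry 0) - f p) ^ 2 ≤ 4 * (energy f).toReal := by
  refine (sq_sub_le hb hf _ p).trans (mul_le_mul_of_nonneg_right ?_ ENNReal.toReal_nonneg)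
  simpa using ENNReal.toReal_mono (by norm_num) (edist_bdry_zero_le hb p)

theorem uniformContinuous_of_energy_ne_top {b : ℕ} (hb : 1 ≤ b) {f : Vertex b → ℝ}
    (hf : energy f ≠ ⊤) : UniformContinuous f := by
  rw [EMetric.uniformContinuous_iff]
  intro ε hε
  rcases eq_or_ne ε ⊤ with rfl | hεt
  · exact ⟨1, one_pos, fun {p q} _ => edist_lt_top _ _⟩
  have hε' : 0 < ε.toReal := ENNReal.toReal_pos hε.ne' hεt
  -- The added 1 keeps the denominator positive when the energy vanishes.
  set E := (energy f).toReal + 1 with hE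
  have hE0 : 0 < E := by positivity
  refine ⟨ENNReal.ofReal (ε.toReal ^ 2 / E), by simpa using by positivity, fun {p q} h => ?_⟩
  have h1 := (ENNReal.lt_ofReal_iff_toReal_lt (edist_vertex_ne_top hb p q)).1 h
  have h2 := sq_sub_le hb hf p q
  rw [edist_dist, ENNReal.ofReal_lt_iff_lt_toReal dist_nonneg hεt, Real.dist_eq]
  refine lt_of_pow_lt_pow_left₀ 2 hε'.le ?_
  rw [sq_abs]
  rw [lt_div_iff₀ hE0] at h1
  refine lt_of_le_of_lt (h2.trans ?_) h1
  exact mul_le_mul_of_nonneg_left (by linarith) ENNReal.toReal_nonneg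

theorem exists_onVertices_eq {b : ℕ} (hb : 1 ≤ b) {f : Vertex b → ℝ} (hf : energy f ≠ ⊤) :
    ∃ u : C(Fractal b, ℝ), onVertices u = f := by
  refine ⟨⟨UniformSpace.Completion.extension f, UniformSpace.Completion.continuous_extension⟩, ?_⟩
  ext p
  exact UniformSpace.Completion.extension_coe (uniformContinuous_of_energy_ne_top hb hf) p

theorem onVertices_injective {b : ℕ} : Function.Injective (onVertices (b := b)) := by
  intro u v h
  ext x
  induction x using UniformSpace.Completion.induction_on with
  | hp => exact isClosed_eq u.continuous v.continuous
  | ih p => exact congrFun h p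

theorem eq_zero_of_energy_eq_zero {b : ℕ} (hb : 1 ≤ b) {u : C(Fractal b, ℝ)}
    (h : energy (onVertices u) = 0) (h0 : onVertices u (.bdry 0) = 0) : u = 0 := by
  refine onVertices_injective (funext fun p => ?_)
  have := sq_sub_bdry_zero_le hb (by rw [h]; exact ENNReal.zero_ne_top) p
  rw [h, h0] at this
  have h2 : onVertices u p ^ 2 = 0 := le_antisymm (by simpa using this) (sq_nonneg _)
  simpa [onVertices] using h2

/-- Pulled back along the address map, the function is continuous on the compact space of infinite
words, so compactness of $K_b$ itself is not needed. -/
theorem integrable_continuousMap {b : ℕ} (hb : 1 ≤ b) (u : C(Fractal b, ℝ)) :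
    Integrable u (selfSimilarMeasure b) := by
  unfold selfSimilarMeasure
  rw [integrable_map_measure u.continuous.aestronglyMeasurable
    (continuous_code hb).measurable.aemeasurable]
  exact (u.continuous.comp (continuous_code hb)).integrable_of_hasCompactSupport
    (HasCompactSupport.of_compactSpace _)

/-! ## The Dirichlet problem -/

/-- The space of functions of finite energy that vanish on the boundary. -/
def dirichletSubmodule (b : ℕ) : Submodule ℝ C(Fractal b, ℝ) where
  carrier := {u | InDomEnergy u ∧ ∀ k, onVertices u (.bdry k) = 0}
  add_mem' := fun {u v} hu hv => ⟨energy_add_ne_top hu.1 hv.1, fun k => by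
    have h1 := hu.2 k
    have h2 := hv.2 k
    simp only [onVertices] at h1 h2 ⊢
    simp [h1, h2]⟩
  zero_mem' := ⟨by
    change energy (0 : Vertex b → ℝ) ≠ ⊤
    simp [energy_zero], fun k => rfl⟩
  smul_mem' := fun c u hu => ⟨energy_smul_ne_top c hu.1, fun k => by
    have h1 := hu.2 k
    simp only [onVertices] at h1 ⊢
    simp [h1]⟩

/-- The space `dirichletSubmodule b`, to be given the norm coming from the energy. -/
def DirichletSpace (b : ℕ) : Type := dirichletSubmodule b

namespace DirichletSpace

variable {b : ℕ}

noncomputable instance : AddCommGroup (DirichletSpace b) :=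
  inferInstanceAs (AddCommGroup (dirichletSubmodule b))

noncomputable instance : Module ℝ (DirichletSpace b) :=
  inferInstanceAs (Module ℝ (dirichletSubmodule b))

/-- The underlying continuous function. -/
def toMap (u : DirichletSpace b) : C(Fractal b, ℝ) := u.1

theorem energy_ne_top (u : DirichletSpace b) : energy (onVertices u.toMap) ≠ ⊤ := u.2.1

theorem bdry_eq_zero (u : DirichletSpace b) (k : Fin 2) : onVertices u.toMap (.bdry k) = 0 := u.2.2 k

/-- The element of `DirichletSpace b` with a given underlying function. -/
def mk (u : C(Fractal b, ℝ)) (hu : InDomEnergy u) (h0 : ∀ k, onVertices u (.bdry k) = 0) :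
    DirichletSpace b := ⟨u, hu, h0⟩

/-- The energy form as an inner product. -/
@[reducible] noncomputable def core (hb : 1 ≤ b) : InnerProductSpace.Core ℝ (DirichletSpace b) where
  inner u v := energyForm (onVertices u.toMap) (onVertices v.toMap)
  conj_inner_symm u v := energyForm_comm hb v.energy_ne_top u.energy_ne_top
  re_inner_nonneg u := by
    rw [energyForm_self hb u.energy_ne_top]
    exact ENNReal.toReal_nonneg
  add_left u v w := energyForm_add_left hb u.energy_ne_top v.energy_ne_top w.energy_ne_top
  smul_left u v c := energyForm_smul_left hb c u.energy_ne_top v.energy_ne_top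
  definite u h := by
    rw [energyForm_self hb u.energy_ne_top, ENNReal.toReal_eq_zero_iff] at h
    exact Subtype.ext (eq_zero_of_energy_eq_zero hb (h.resolve_right u.energy_ne_top) (u.2.2 0))

noncomputable instance [hb : Fact (1 ≤ b)] : NormedAddCommGroup (DirichletSpace b) :=
  (core hb.out).toNormedAddCommGroup

noncomputable instance [hb : Fact (1 ≤ b)] : InnerProductSpace ℝ (DirichletSpace b) :=
  InnerProductSpace.ofCore (core hb.out).toCore

theorem inner_eq [hb : Fact (1 ≤ b)] (u v : DirichletSpace b) :
    inner ℝ u v = energyForm (onVertices u.toMap) (onVertices v.toMap) := rfl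

theorem norm_sq_eq [hb : Fact (1 ≤ b)] (u : DirichletSpace b) :
    ‖u‖ ^ 2 = (energy (onVertices u.toMap)).toReal := by
  rw [← real_inner_self_eq_norm_sq, inner_eq, energyForm_self hb.out u.energy_ne_top]

theorem abs_toMap_le [hb : Fact (1 ≤ b)] (u : DirichletSpace b) (x : Fractal b) :
    |u.toMap x| ≤ 2 * ‖u‖ := by
  induction x using UniformSpace.Completion.induction_on with
  | hp => exact isClosed_le u.toMap.continuous.abs continuous_const
  | ih p =>
    have h := sq_sub_bdry_zero_le hb.out u.energy_ne_top p
    rw [u.bdry_eq_zero, ← norm_sq_eq] at h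
    refine abs_le_of_sq_le_sq (b := 2 * ‖u‖) ?_ (by positivity)
    calc _ = (0 - onVertices u.toMap p) ^ 2 := by simp [onVertices]
      _ ≤ _ := h.trans_eq (by ring)

/-- The norm dominates the supremum, so a Cauchy sequence converges at every vertex. Each graph
energy is a finite sum and passes to the limit; a bound uniform in the level then controls the
energy of the limit, as in Fatou's lemma. -/
instance [hb : Fact (1 ≤ b)] : CompleteSpace (DirichletSpace b) := by
  refine Metric.complete_of_cauchySeq_tendsto fun u hu => ?_
  have hsub : ∀ m n (x : Fractal b), (u m - u n).toMap x = (u m).toMap x - (u n).toMap x :=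
    fun m n x => rfl
  have hpt : ∀ p : Vertex b, ∃ c, Tendsto (fun n => onVertices (u n).toMap p) atTop (𝓝 c) := by
    intro p
    refine cauchySeq_tendsto_of_complete (Metric.cauchySeq_iff.2 fun ε hε => ?_)
    obtain ⟨N, hN⟩ := Metric.cauchySeq_iff.1 hu (ε / 2) (by positivity)
    refine ⟨N, fun m hm n hn => ?_⟩
    have h1 := hN m hm n hn
    have h2 := abs_toMap_le (u m - u n) p
    rw [hsub] at h2
    rw [dist_eq_norm] at h1
    rw [Real.dist_eq]
    unfold onVertices
    linarith
  choose g hg using hpt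
  -- The level $\ell$ is fixed while the other index tends to infinity; $N$ does not depend on
  -- $\ell$.
  have hclose : ∀ ε > 0, ∃ N, ∀ n ≥ N, ∀ ℓ,
      graphEnergy ℓ (g - onVertices (u n).toMap) ≤ ε ^ 2 := by
    intro ε hε
    obtain ⟨N, hN⟩ := Metric.cauchySeq_iff.1 hu ε hε
    refine ⟨N, fun n hn ℓ => ?_⟩
    have hlim : Tendsto (fun m => graphEnergy ℓ (onVertices (u m).toMap - onVertices (u n).toMap))
        atTop (𝓝 (graphEnergy ℓ (g - onVertices (u n).toMap))) := by
      unfold graphEnergy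
      refine Tendsto.const_mul _ (tendsto_finsetSum _ fun w _ => ?_)
      exact (((hg _).sub tendsto_const_nhds).sub ((hg _).sub tendsto_const_nhds)).pow 2
    refine le_of_tendsto hlim (eventually_atTop.2 ⟨N, fun m hm => ?_⟩)
    have h1 := hN m hm n hn
    rw [dist_eq_norm] at h1
    refine (graphEnergy_le_energy (u m - u n).energy_ne_top ℓ).trans ?_
    rw [← norm_sq_eq]
    exact pow_le_pow_left₀ (norm_nonneg _) h1.le 2
  have hgE : energy g ≠ ⊤ := by
    obtain ⟨N, hN⟩ := hclose 1 one_pos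
    have := energy_add_ne_top (energy_ne_top_of_le (hN N le_rfl)) (u N).energy_ne_top
    rwa [sub_add_cancel] at this
  obtain ⟨U, hU⟩ := exists_onVertices_eq hb.out hgE
  have hU0 : ∀ k, onVertices U (.bdry k) = 0 := by
    intro k
    rw [hU]
    refine tendsto_nhds_unique (hg _) ?_
    simp only [bdry_eq_zero]
    exact tendsto_const_nhds
  refine ⟨mk U (by unfold InDomEnergy; rwa [hU]) hU0, Metric.tendsto_atTop.2 fun ε hε => ?_⟩
  obtain ⟨N, hN⟩ := hclose (ε / 2) (by positivity)
  refine ⟨N, fun n hn => ?_⟩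
  rw [dist_comm, dist_eq_norm]
  refine lt_of_le_of_lt ?_ (half_lt_self hε)
  refine le_of_sq_le_sq ?_ (by positivity)
  rw [norm_sq_eq]
  refine ENNReal.toReal_le_of_le_ofReal (by positivity) (energy_le_ofReal fun ℓ => ?_)
  have := hN n hn ℓ
  rw [← hU] at this
  exact this

end DirichletSpace

/-- Solvability of the Dirichlet problem with zero boundary values. -/
theorem exists_isLaplacian_bdry_eq_zero {b : ℕ} (hb : 1 ≤ b) (f : C(Fractal b, ℝ)) :
    ∃ u, IsLaplacian u f ∧ ∀ k, onVertices u (.bdry k) = 0 := by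
  have : Fact (1 ≤ b) := ⟨hb⟩
  have hint : ∀ v : C(Fractal b, ℝ), Integrable (fun x => f x * v x) (selfSimilarMeasure b) :=
    fun v => integrable_continuousMap hb (f * v)
  let φ : DirichletSpace b →ₗ[ℝ] ℝ :=
    { toFun := fun v => -∫ x, f x * v.toMap x ∂(selfSimilarMeasure b)
      map_add' := fun v w => by
        rw [← neg_add, ← integral_add (hint _) (hint _)]
        simp only [← mul_add]
        rfl
      map_smul' := fun c v => by
        simp only [RingHom.id_apply, smul_eq_mul, mul_neg, ← integral_const_mul,
          mul_left_comm c]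
        rfl }
  -- Boundedness of the functional comes from the supremum bound $|v|\le 2\|v\|$ for the energy
  -- norm.
  have hφ : ∀ v, ‖φ v‖ ≤ (2 * ∫ x, |f x| ∂(selfSimilarMeasure b)) * ‖v‖ := by
    intro v
    change ‖-∫ x, f x * v.toMap x ∂(selfSimilarMeasure b)‖ ≤ _
    rw [norm_neg]
    refine (norm_integral_le_integral_norm _).trans ?_
    rw [show 2 * (∫ x, |f x| ∂(selfSimilarMeasure b)) * ‖v‖ =
      (∫ x, |f x| ∂(selfSimilarMeasure b)) * (2 * ‖v‖) by ring, ← integral_mul_const]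
    refine integral_mono (hint _).norm ((integrable_continuousMap hb f).abs.mul_const _)
      fun x => ?_
    simp only [Real.norm_eq_abs, abs_mul]
    exact mul_le_mul_of_nonneg_left (v.abs_toMap_le x) (abs_nonneg _)
  -- Riesz representation for the energy inner product is exactly the weak equation $\Delta u = f$.
  let u := (InnerProductSpace.toDual ℝ (DirichletSpace b)).symm (φ.mkContinuous _ hφ)
  refine ⟨u.toMap, ⟨u.energy_ne_top, fun g hg hg0 => ?_⟩, u.2.2⟩
  have h : inner ℝ u (DirichletSpace.mk g hg hg0) = φ (DirichletSpace.mk g hg hg0) :=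
    InnerProductSpace.toDual_symm_apply
  exact h

/-! ## The Laplacian -/

theorem integrable_mul_continuousMap {b : ℕ} (hb : 1 ≤ b) (u v : C(Fractal b, ℝ)) :
    Integrable (fun x => u x * v x) (selfSimilarMeasure b) :=
  integrable_continuousMap hb (u * v)

theorem IsLaplacian.add {b : ℕ} (hb : 1 ≤ b) {u u' f f' : C(Fractal b, ℝ)}
    (h : IsLaplacian u f) (h' : IsLaplacian u' f') : IsLaplacian (u + u') (f + f') := by
  refine ⟨energy_add_ne_top h.1 h'.1, fun g hg hg0 => ?_⟩
  have h1 := energyForm_add_left hb h.1 h'.1 hg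
  rw [h.2 g hg hg0, h'.2 g hg hg0, ← neg_add, ← integral_add
    (integrable_mul_continuousMap hb _ _) (integrable_mul_continuousMap hb _ _)] at h1
  simp only [← add_mul] at h1
  exact h1

theorem IsLaplacian.smul {b : ℕ} (hb : 1 ≤ b) (c : ℝ) {u f : C(Fractal b, ℝ)}
    (h : IsLaplacian u f) : IsLaplacian (c • u) (c • f) := by
  refine ⟨energy_smul_ne_top c h.1, fun g hg hg0 => ?_⟩
  have h1 := energyForm_smul_left hb c h.1 hg
  rw [h.2 g hg hg0, mul_neg, ← integral_const_mul] at h1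
  simp only [← mul_assoc] at h1
  exact h1

theorem IsLaplacian.sub {b : ℕ} (hb : 1 ≤ b) {u u' f f' : C(Fractal b, ℝ)}
    (h : IsLaplacian u f) (h' : IsLaplacian u' f') : IsLaplacian (u - u') (f - f') := by
  simpa [sub_eq_add_neg] using h.add hb (h'.smul hb (-1))

theorem isLaplacian_zero {b : ℕ} : IsLaplacian (0 : C(Fractal b, ℝ)) 0 := by
  have h0 : onVertices (0 : C(Fractal b, ℝ)) = 0 := rfl
  refine ⟨by simp [InDomEnergy, h0, energy_zero], fun g _ _ => ?_⟩
  have : energy (-onVertices g) = energy (onVertices g) := by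
    unfold energy
    congr 1
    ext ℓ
    rw [← neg_one_smul ℝ (onVertices g), graphEnergy_smul]
    norm_num
  simp [h0, energyForm, this]

theorem IsLaplacian.sum {b : ℕ} (hb : 1 ≤ b) {ι : Type*} (s : Finset ι)
    {u f : ι → C(Fractal b, ℝ)} (h : ∀ i ∈ s, IsLaplacian (u i) (f i)) :
    IsLaplacian (∑ i ∈ s, u i) (∑ i ∈ s, f i) := by
  classical
  induction s using Finset.induction_on with
  | empty => simpa using isLaplacian_zero
  | insert a s ha ih =>
    rw [Finset.sum_insert ha, Finset.sum_insert ha]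
    exact (h a (Finset.mem_insert_self _ _)).add hb
      (ih fun i hi => h i (Finset.mem_insert_of_mem hi))

/-- Uniqueness in the Dirichlet problem. -/
theorem IsLaplacian.unique {b : ℕ} (hb : 1 ≤ b) {u v f : C(Fractal b, ℝ)} (hu : IsLaplacian u f)
    (hv : IsLaplacian v f) (h : ∀ k, onVertices u (.bdry k) = onVertices v (.bdry k)) : u = v := by
  have hw := hu.sub hb hv
  have h0 : ∀ k, onVertices (u - v) (.bdry k) = 0 := fun k => sub_eq_zero.2 (h k)
  -- The difference is tested against itself, so its energy vanishes.
  have h1 := hw.2 (u - v) hw.1 h0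
  rw [energyForm_self hb hw.1] at h1
  simp only [sub_self, ContinuousMap.zero_apply, zero_mul, integral_zero, neg_zero,
    ENNReal.toReal_eq_zero_iff] at h1
  exact sub_eq_zero.1 (eq_zero_of_energy_eq_zero hb (h1.resolve_right hw.1) (h0 0))

/-! ## Harmonic functions -/

/-- The value at the new vertex `inner [] k` of the harmonic function with boundary values `c`. -/
noncomputable def harmonicMid (b : ℕ) (c : Fin 2 → ℝ) (k : Fin 2) : ℝ :=
  ((b + 1) * c k + b * c k.rev) / (2 * b + 1)

/-- The boundary values on the cell `i` of the harmonic function with boundary values `c`. -/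
noncomputable def harmonicCell {b : ℕ} (c : Fin 2 → ℝ) (i : Fin (b + 2)) : Fin 2 → ℝ := fun k =>
  Fin.addCases (fun _ => harmonicMid b c k) (fun m => if k = m then c m else harmonicMid b c m) i

/-- The harmonic function with boundary values `c`. -/
noncomputable def harmonic {b : ℕ} (c : Fin 2 → ℝ) : Vertex b → ℝ
  | .bdry k => c k
  | .inner w k => harmonicMid b (w.foldl harmonicCell c) k

theorem harmonic_comp_F {b : ℕ} (c : Fin 2 → ℝ) (i : Fin (b + 2)) :
    harmonic c ∘ F i = harmonic (harmonicCell c i) := by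
  ext p
  match p with
  | .inner w k => rfl
  | .bdry k =>
    induction i using Fin.addCases with
    | left i => simp [F, harmonic, harmonicCell]
    | right m =>
      simp only [F, harmonicCell, Function.comp_apply, Fin.addCases_right, harmonic]
      split_ifs <;> simp

/-- Viewed as an electric flow on $G_1$, the harmonic function carries total current $r(c_0-c_1)$
through each of its three stages in series: edge, $b$ parallel edges, edge. Hence the increments of
$g$ telescope and its values at the new vertices drop out; $r^{-1}$ restores the level-0 value. -/
theorem graphForm_harmonic {b : ℕ} (hb : 1 ≤ b) (ℓ : ℕ) (c : Fin 2 → ℝ) (g : Vertex b → ℝ) :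
    graphForm ℓ (harmonic c) g = (c 0 - c 1) * (g (.bdry 0) - g (.bdry 1)) := by
  induction ℓ generalizing c g with
  | zero => rw [graphForm_zero]; rfl
  | succ ℓ ih =>
    have hb' : (0 : ℝ) < b := by exact_mod_cast hb
    rw [graphForm_succ]
    simp only [harmonic_comp_F, ih]
    rw [Fin.sum_univ_add]
    simp [F, harmonicCell, harmonicMid, Fin.sum_univ_two, renorm]
    field_simp
    ring

theorem energy_harmonic_ne_top {b : ℕ} (hb : 1 ≤ b) (c : Fin 2 → ℝ) :
    energy (harmonic c : Vertex b → ℝ) ≠ ⊤ :=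
  energy_ne_top_of_le (C := (c 0 - c 1) * (c 0 - c 1)) fun ℓ => by
    rw [← graphForm_self, graphForm_harmonic hb]; rfl

/-- Against a test function vanishing on the boundary the graph form is zero at every level. -/
theorem exists_isLaplacian_harmonic {b : ℕ} (hb : 1 ≤ b) (c : Fin 2 → ℝ) :
    ∃ u : C(Fractal b, ℝ), IsLaplacian u 0 ∧ onVertices u = harmonic c := by
  obtain ⟨u, hu⟩ := exists_onVertices_eq hb (energy_harmonic_ne_top hb c)
  have hfin : energy (onVertices u) ≠ ⊤ := hu ▸ energy_harmonic_ne_top hb c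
  refine ⟨u, ⟨hfin, fun g hg hg0 => ?_⟩, hu⟩
  refine tendsto_nhds_unique (tendsto_graphForm hb hfin hg) ?_
  simp [hu, graphForm_harmonic hb, hg0]

theorem onVertices_eq_harmonic {b : ℕ} (hb : 1 ≤ b) {u : C(Fractal b, ℝ)} (hu : IsLaplacian u 0) :
    onVertices u = harmonic fun k => onVertices u (.bdry k) := by
  obtain ⟨v, hv, hv'⟩ := exists_isLaplacian_harmonic hb fun k => onVertices u (.bdry k)
  rw [← hv', hu.unique hb hv fun k => by rw [hv']; rfl]

/-! ## Self-similarity -/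

/-- The function `u ∘ F_i` on `K_b`. -/
noncomputable def compF {b : ℕ} (i : Fin (b + 2)) (u : C(Fractal b, ℝ)) : C(Fractal b, ℝ) :=
  u.comp ⟨FK i, continuous_FK i⟩

theorem onVertices_compF {b : ℕ} (hb : 1 ≤ b) (i : Fin (b + 2)) (u : C(Fractal b, ℝ)) :
    onVertices (compF i u) = onVertices u ∘ F i := by
  ext p
  exact congrArg u (FK_coe hb i p)

theorem integral_selfSimilar {b : ℕ} (hb : 1 ≤ b) (u : C(Fractal b, ℝ)) :
    ∫ x, u x ∂(selfSimilarMeasure b) =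
      ((b : ℝ) + 2)⁻¹ * ∑ i, ∫ x, compF i u x ∂(selfSimilarMeasure b) := by
  have hμ : selfSimilarMeasure b =
      ((b : ℝ≥0∞) + 2)⁻¹ • ∑ i, (selfSimilarMeasure b).map (FK i) := by
    ext A hA
    rw [selfSimilarMeasure_apply hb hA, Measure.smul_apply, Measure.finsetSum_apply, smul_eq_mul]
    congr 1
    exact Finset.sum_congr rfl fun i _ =>
      (Measure.map_apply (continuous_FK i).measurable hA).symm
  conv_lhs => rw [hμ]
  rw [integral_smul_measure, integral_finsetSum_measure]
  · simp only [smul_eq_mul, ENNReal.toReal_inv]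
    congr 1
    refine Finset.sum_congr rfl fun i _ => ?_
    exact integral_map (continuous_FK i).measurable.aemeasurable
      u.continuous.aestronglyMeasurable
  · intro i _
    rw [integrable_map_measure u.continuous.aestronglyMeasurable
      (continuous_FK i).measurable.aemeasurable]
    exact integrable_continuousMap hb (compF i u)

/-- The function on `V_*` that equals `g ∘ F_i⁻¹` on the cell `i` and vanishes elsewhere, for `g`
vanishing on the boundary. -/
def extendByZero {b : ℕ} (i : Fin (b + 2)) (g : Vertex b → ℝ) : Vertex b → ℝ
  | .bdry _ => 0
  | .inner [] _ => 0
  | .inner (j :: w) k => if j = i then g (.inner w k) else 0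

theorem extendByZero_comp_F {b : ℕ} {g : Vertex b → ℝ} (hg : ∀ k, g (.bdry k) = 0)
    (i j : Fin (b + 2)) : extendByZero i g ∘ F j = if j = i then g else 0 := by
  have h0 : ∀ k, extendByZero i g (F j (.bdry k)) = 0 := by
    intro k
    induction j using Fin.addCases with
    | left j => simp [F, extendByZero]
    | right m =>
      simp only [F, Fin.addCases_right]
      split_ifs <;> simp [extendByZero]
  ext p
  match p with
  | .bdry k => rw [Function.comp_apply, h0]; split_ifs <;> simp [hg]
  | .inner w k =>
    change (if j = i then g (.inner w k) else 0) = _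
    split_ifs <;> rfl

theorem graphForm_zero_right {b : ℕ} (ℓ : ℕ) (f : Vertex b → ℝ) : graphForm ℓ f 0 = 0 := by
  simp [graphForm]

theorem graphForm_extendByZero {b : ℕ} {g : Vertex b → ℝ} (hg : ∀ k, g (.bdry k) = 0)
    (i : Fin (b + 2)) (ℓ : ℕ) (f : Vertex b → ℝ) :
    graphForm (ℓ + 1) f (extendByZero i g) = (renorm b)⁻¹ * graphForm ℓ (f ∘ F i) g := by
  rw [graphForm_succ, Finset.sum_eq_single i]
  · rw [extendByZero_comp_F hg, if_pos rfl]
  · intro j _ hj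
    rw [extendByZero_comp_F hg, if_neg hj, graphForm_zero_right]
  · simp

theorem energy_extendByZero_ne_top {b : ℕ} {g : Vertex b → ℝ} (hg : ∀ k, g (.bdry k) = 0)
    (hgE : energy g ≠ ⊤) (i : Fin (b + 2)) : energy (extendByZero i g) ≠ ⊤ := by
  have hr := inv_nonneg.2 (renorm_nonneg b)
  refine energy_ne_top_of_le (C := (renorm b)⁻¹ * (energy g).toReal) fun ℓ => ?_
  cases ℓ with
  | zero =>
    rw [graphEnergy_zero]
    simpa [extendByZero] using mul_nonneg hr ENNReal.toReal_nonneg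
  | succ ℓ =>
    rw [← graphForm_self, graphForm_extendByZero hg, extendByZero_comp_F hg, if_pos rfl,
      graphForm_self]
    exact mul_le_mul_of_nonneg_left (graphEnergy_le_energy hgE ℓ) hr

/-- The equation for $u$ is tested with $G$, the test function $g$ moved to cell $i$ and extended by
zero. The energy side gains $r^{-1}$ and the integral side $1/(b+2)$, whose quotient is the scaling
constant. -/
theorem IsLaplacian.compF {b : ℕ} (hb : 1 ≤ b) (i : Fin (b + 2)) {u f : C(Fractal b, ℝ)}
    (h : IsLaplacian u f) :
    IsLaplacian (compF i u) ((renorm b / (b + 2)) • BubbleDiamond.compF i f) := by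
  have hb' : (0 : ℝ) < b := by exact_mod_cast hb
  have hr : renorm b ≠ 0 := by unfold renorm; positivity
  have hE : energy (onVertices (BubbleDiamond.compF i u)) ≠ ⊤ := by
    rw [onVertices_compF hb]
    exact energy_comp_F_ne_top hb i h.1
  refine ⟨hE, fun g hg hg0 => ?_⟩
  have hGE := energy_extendByZero_ne_top hg0 hg i
  obtain ⟨G, hG⟩ := exists_onVertices_eq hb hGE
  have hGF : ∀ j, BubbleDiamond.compF j G = if j = i then g else 0 := by
    intro j
    apply onVertices_injective
    rw [onVertices_compF hb, hG, extendByZero_comp_F hg0]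
    split_ifs <;> rfl
  have h1 := h.2 G (by rwa [InDomEnergy, hG]) fun k => by rw [hG]; rfl
  have h2 : energyForm (onVertices u) (onVertices G) =
      (renorm b)⁻¹ * energyForm (onVertices (BubbleDiamond.compF i u)) (onVertices g) := by
    rw [hG]
    -- Level $\ell+1$ on the whole fractal corresponds to level $\ell$ on the cell, so the limit is
    -- compared along the shifted sequence.
    refine tendsto_nhds_unique
      ((tendsto_graphForm hb h.1 hGE).comp (tendsto_add_atTop_nat 1)) ?_
    refine ((tendsto_graphForm hb hE hg).const_mul _).congr fun ℓ => ?_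
    rw [Function.comp_apply, graphForm_extendByZero hg0, onVertices_compF hb]
  have h3 := integral_selfSimilar hb (f * G)
  rw [Finset.sum_eq_single i] at h3
  · have h4 : ∀ x, BubbleDiamond.compF i (f * G) x = BubbleDiamond.compF i f x * g x := by
      intro x
      have : BubbleDiamond.compF i G x = g x := by rw [hGF, if_pos rfl]
      rw [← this]; rfl
    simp only [h4, ContinuousMap.mul_apply] at h3
    rw [h2, h3, inv_mul_eq_iff_eq_mul₀ hr] at h1
    rw [h1]
    simp only [ContinuousMap.smul_apply, smul_eq_mul, mul_assoc, integral_const_mul]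
    field_simp
  · intro j _ hj
    have h4 : ∀ x, BubbleDiamond.compF j (f * G) x = 0 := by
      intro x
      have : BubbleDiamond.compF j G x = 0 := by rw [hGF, if_neg hj]; rfl
      change BubbleDiamond.compF j f x * BubbleDiamond.compF j G x = 0
      rw [this, mul_zero]
    simp [h4]
  · simp

/-! ## The reflection -/

/-- The action on cells of the reflection exchanging the two boundary points. -/
def reflectLetter {b : ℕ} (i : Fin (b + 2)) : Fin (b + 2) :=
  Fin.addCases (Fin.castAdd 2) (fun k => Fin.natAdd b k.rev) i

theorem reflectLetter_involutive {b : ℕ} : Function.Involutive (reflectLetter (b := b)) := by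
  intro i
  induction i using Fin.addCases <;> simp [reflectLetter]

/-- The reflection of `V_*` exchanging the two boundary points. -/
def reflect {b : ℕ} : Vertex b → Vertex b
  | .bdry k => .bdry k.rev
  | .inner w k => .inner (w.map reflectLetter) k.rev

theorem reflect_F {b : ℕ} (i : Fin (b + 2)) (p : Vertex b) :
    reflect (F i p) = F (reflectLetter i) (reflect p) := by
  match p with
  | .inner w k => rfl
  | .bdry k =>
    induction i using Fin.addCases with
    | left i => simp [F, reflect, reflectLetter]
    | right m =>
      simp only [F, reflect, reflectLetter, Fin.addCases_right, Fin.rev_inj]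
      split_ifs <;> rfl

theorem reflect_applyWord {b : ℕ} (w : List (Fin (b + 2))) (p : Vertex b) :
    reflect (applyWord w p) = applyWord (w.map reflectLetter) (reflect p) := by
  induction w with
  | nil => rfl
  | cons i w ih =>
    change reflect (F i (applyWord w p)) = F _ (applyWord _ _)
    rw [reflect_F, ih]

theorem graphEnergy_comp_reflect {b : ℕ} (ℓ : ℕ) (f : Vertex b → ℝ) :
    graphEnergy ℓ (f ∘ reflect) = graphEnergy ℓ f := by
  induction ℓ generalizing f with
  | zero =>
    simp only [graphEnergy_zero, Function.comp_apply, reflect]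
    exact sub_sq_comm _ _
  | succ ℓ ih =>
    have h : ∀ i, (f ∘ reflect) ∘ F i = (f ∘ F (reflectLetter i)) ∘ reflect := by
      intro i
      ext p
      simp [reflect_F]
    simp only [graphEnergy_succ, h, ih]
    congr 1
    exact Equiv.sum_comp reflectLetter_involutive.toPerm fun i => graphEnergy ℓ (f ∘ F i)

theorem energy_comp_reflect {b : ℕ} (f : Vertex b → ℝ) : energy (f ∘ reflect) = energy f := by
  simp only [energy, graphEnergy_comp_reflect]

theorem energyForm_comp_reflect {b : ℕ} (f g : Vertex b → ℝ) :
    energyForm (f ∘ reflect) (g ∘ reflect) = energyForm f g := by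
  have h1 := energy_comp_reflect (f + g)
  have h2 := energy_comp_reflect (f - g)
  unfold energyForm
  rw [← h1, ← h2]
  rfl

theorem reflect_involutive {b : ℕ} : Function.Involutive (reflect (b := b)) := by
  intro p
  match p with
  | .bdry k => simp [reflect]
  | .inner w k => simp [reflect, reflectLetter_involutive.comp_self]

theorem lipschitzWith_reflect {b : ℕ} : LipschitzWith 1 (reflect (b := b)) := by
  intro p q
  simp only [ENNReal.coe_one, one_mul]
  refine le_sInf fun R hR => sInf_le fun f hf => ?_
  have := hR (f ∘ reflect) (by rwa [energy_comp_reflect])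
  rwa [energy_comp_reflect] at this

/-- The reflection of `K_b`. -/
noncomputable def reflectK {b : ℕ} : C(Fractal b, Fractal b) :=
  ⟨UniformSpace.Completion.map reflect, UniformSpace.Completion.continuous_map⟩

theorem reflectK_coe {b : ℕ} (p : Vertex b) : reflectK (p : Fractal b) = (reflect p : Fractal b) :=
  UniformSpace.Completion.map_coe lipschitzWith_reflect.uniformContinuous p

theorem onVertices_comp_reflectK {b : ℕ} (u : C(Fractal b, ℝ)) :
    onVertices (u.comp reflectK) = onVertices u ∘ reflect := by
  ext p
  exact congrArg u (reflectK_coe p)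

theorem tendsto_coe_of_edist_le {b : ℕ} {p q : ℕ → Vertex b} {x : Fractal b}
    (hp : Tendsto (fun m => (p m : Fractal b)) atTop (𝓝 x))
    (h : ∀ m, edist (p m) (q m) ≤ ENNReal.ofReal (renorm b) ^ m) :
    Tendsto (fun m => (q m : Fractal b)) atTop (𝓝 x) := by
  have hpq : Tendsto (fun m => (p m, q m)) atTop (uniformity (Vertex b)) := by
    refine uniformity_basis_edist.tendsto_right_iff.2 fun ε hε => ?_
    filter_upwards [(ENNReal.tendsto_pow_atTop_nhds_zero_of_lt_one
      (ofReal_renorm_lt_one (b := b))).eventually_lt_const hε] with m hm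
    exact (h m).trans_lt hm
  have hcoe : Tendsto (fun x : Vertex b × Vertex b => ((x.1 : Fractal b), (x.2 : Fractal b)))
      (uniformity (Vertex b)) (uniformity (Fractal b)) :=
    UniformSpace.Completion.uniformContinuous_coe _
  exact hp.congr_uniformity (hcoe.comp hpq)

/-- The point with a given address is also the limit of the images of $q_2$. This is needed because
`code` is built from $q_1$, which the reflection sends to $q_2$. -/
theorem tendsto_applyWord_bdry_one {b : ℕ} (hb : 1 ≤ b) (ω : ℕ → Fin (b + 2)) :
    Tendsto (fun m => ((applyWord (List.ofFn fun j : Fin m => ω j) (.bdry 1) : Vertex b) :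
      Fractal b)) atTop (𝓝 (code ω)) := by
  refine tendsto_coe_of_edist_le (tendsto_code hb ω) fun m => ?_
  have h := edist_applyWord_le hb (List.ofFn fun j : Fin m => ω j) (.bdry 0) (.bdry 1)
  rw [List.length_ofFn] at h
  exact h.trans (mul_le_of_le_one_right' edist_bdry_le)

theorem code_reflectLetter {b : ℕ} (hb : 1 ≤ b) (ω : ℕ → Fin (b + 2)) :
    code (fun n => reflectLetter (ω n)) = reflectK (code ω) := by
  refine tendsto_nhds_unique (tendsto_code hb _) ?_
  refine ((reflectK.continuous.tendsto _).comp (tendsto_applyWord_bdry_one hb ω)).congr fun m => ?_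
  rw [Function.comp_apply, reflectK_coe, reflect_applyWord, List.map_ofFn]
  rfl

theorem map_reflectLetter_uniform {b : ℕ} :
    (PMF.uniformOfFintype (Fin (b + 2))).toMeasure.map reflectLetter =
      (PMF.uniformOfFintype (Fin (b + 2))).toMeasure := by
  ext S hS
  rw [Measure.map_apply (measurable_of_finite _) hS, uniform_apply, uniform_apply]
  congr 1
  exact Equiv.sum_comp reflectLetter_involutive.toPerm fun i => S.indicator (1 : Fin (b + 2) → ℝ≥0∞) i

/-- On addresses the reflection permutes letters one by one, and the uniform law on letters is
invariant under permutations. -/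
theorem map_reflectK_selfSimilarMeasure {b : ℕ} (hb : 1 ≤ b) :
    (selfSimilarMeasure b).map reflectK = selfSimilarMeasure b := by
  have hm : Measurable (code (b := b)) := (continuous_code hb).measurable
  unfold selfSimilarMeasure
  have hmap : Measurable fun (ω : ℕ → Fin (b + 2)) n => reflectLetter (ω n) :=
    measurable_pi_lambda _ fun n => (measurable_of_finite _).comp (measurable_pi_apply n)
  rw [Measure.map_map reflectK.continuous.measurable hm, show (reflectK ∘ code (b := b)) =
    code ∘ fun ω n => reflectLetter (ω n) from funext fun ω => (code_reflectLetter hb ω).symm,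
    ← Measure.map_map hm hmap, Measure.infinitePi_map_pi _ fun _ => measurable_of_finite _]
  simp only [map_reflectLetter_uniform]

theorem integral_comp_reflectK {b : ℕ} (hb : 1 ≤ b) (u : C(Fractal b, ℝ)) :
    ∫ x, u (reflectK x) ∂(selfSimilarMeasure b) = ∫ x, u x ∂(selfSimilarMeasure b) := by
  conv_rhs => rw [← map_reflectK_selfSimilarMeasure hb]
  exact (integral_map reflectK.continuous.measurable.aemeasurable
    u.continuous.aestronglyMeasurable).symm

theorem reflectK_comp_reflectK {b : ℕ} (u : C(Fractal b, ℝ)) :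
    (u.comp reflectK).comp reflectK = u := by
  apply onVertices_injective
  rw [onVertices_comp_reflectK, onVertices_comp_reflectK, Function.comp_assoc,
    reflect_involutive.comp_self, Function.comp_id]

theorem IsLaplacian.comp_reflectK {b : ℕ} (hb : 1 ≤ b) {u f : C(Fractal b, ℝ)}
    (h : IsLaplacian u f) : IsLaplacian (u.comp reflectK) (f.comp reflectK) := by
  refine ⟨?_, fun g hg hg0 => ?_⟩
  · rw [InDomEnergy, onVertices_comp_reflectK, energy_comp_reflect]
    exact h.1
  -- The equation is tested with the reflected $g$; reflecting both arguments of the form then moves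
  -- the reflection onto $u$.
  have h1 := h.2 (g.comp reflectK)
    (by rwa [InDomEnergy, onVertices_comp_reflectK, energy_comp_reflect])
    fun k => by rw [onVertices_comp_reflectK]; exact hg0 _
  rw [onVertices_comp_reflectK, ← energyForm_comp_reflect, Function.comp_assoc,
    reflect_involutive.comp_self, Function.comp_id, ← onVertices_comp_reflectK] at h1
  refine h1.trans (congrArg Neg.neg ((integral_comp_reflectK hb (f * g.comp reflectK)).symm.trans ?_))
  congr 1
  ext x
  have h2 := DFunLike.congr_fun (reflectK_comp_reflectK g) x
  change f (reflectK x) * ((g.comp reflectK).comp reflectK) x = _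
  rw [h2]
  rfl

/-! ## The multiharmonic basis -/

theorem IsMultiharmonicBasis.unique {b : ℕ} (hb : 1 ≤ b) {j : ℕ} {k : Fin 2}
    {u u' : C(Fractal b, ℝ)} (hu : IsMultiharmonicBasis j k u)
    (hu' : IsMultiharmonicBasis j k u') : u = u' := by
  obtain ⟨v, rfl, hv, hv0, hvb⟩ := hu
  obtain ⟨v', rfl, hv', hv0', hvb'⟩ := hu'
  -- Induction downwards from $\Delta^{j+1}u = 0$: equal Laplacians and equal boundary values force
  -- $\Delta^m u$ to agree.
  have key : ∀ d m, m + d = j + 1 → v m = v' m := by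
    intro d
    induction d with
    | zero => rintro m rfl; exact hv0.trans hv0'.symm
    | succ d ih =>
      intro m hm
      have h1 := hv m (by omega)
      have h2 := hv' m (by omega)
      rw [← ih (m + 1) (by omega)] at h2
      exact h1.unique hb h2 fun n => by rw [hvb m (by omega), hvb' m (by omega)]
  exact key (j + 1) 0 (by omega)

theorem IsMultiharmonicBasis.zero {b : ℕ} {k : Fin 2} {u : C(Fractal b, ℝ)}
    (hu : IsMultiharmonicBasis 0 k u) :
    IsLaplacian u 0 ∧ ∀ n, onVertices u (.bdry n) = if n = k then 1 else 0 := by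
  obtain ⟨v, rfl, hv, hv0, hvb⟩ := hu
  exact ⟨hv0 ▸ hv 0 le_rfl, fun n => by simpa using hvb 0 le_rfl n⟩

theorem IsMultiharmonicBasis.succ {b : ℕ} {j : ℕ} {k : Fin 2} {u : C(Fractal b, ℝ)}
    (hu : IsMultiharmonicBasis (j + 1) k u) :
    (∃ u', IsMultiharmonicBasis j k u' ∧ IsLaplacian u u') ∧
      ∀ n, onVertices u (.bdry n) = 0 := by
  obtain ⟨v, rfl, hv, hv0, hvb⟩ := hu
  refine ⟨⟨v 1, ⟨fun m => v (m + 1), rfl, fun m hm => hv (m + 1) (by omega), hv0,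
    fun m hm n => ?_⟩, hv 0 (by omega)⟩, fun n => ?_⟩
  · simpa using hvb (m + 1) (by omega) n
  · simpa using hvb 0 (by omega) n

/-- The case $j=0$ is harmonic. Each further function solves the Dirichlet problem with zero
boundary values and the previous one as right-hand side, prepended to the list of iterated
Laplacians. -/
theorem exists_isMultiharmonicBasis {b : ℕ} (hb : 1 ≤ b) (j : ℕ) (k : Fin 2) :
    ∃ u : C(Fractal b, ℝ), IsMultiharmonicBasis j k u := by
  induction j with
  | zero =>
    obtain ⟨u, hu, hu'⟩ := exists_isLaplacian_harmonic hb fun n => if n = k then 1 else 0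
    refine ⟨u, fun m => if m = 0 then u else 0, rfl, fun m hm => ?_, rfl, fun m hm n => ?_⟩
    · obtain rfl : m = 0 := by omega
      exact hu
    · obtain rfl : m = 0 := by omega
      simp [hu', harmonic]
  | succ j ih =>
    obtain ⟨_, v, rfl, hv, hv0, hvb⟩ := ih
    obtain ⟨u, hu, hub⟩ := exists_isLaplacian_bdry_eq_zero hb (v 0)
    refine ⟨u, fun m => Nat.casesOn m u v, rfl, fun m hm => ?_, hv0, fun m hm n => ?_⟩
    · cases m with
      | zero => exact hu
      | succ m => exact hv m (by omega)
    · cases m with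
      | zero => simpa using hub n
      | succ m => simpa using hvb m (by omega) n

theorem IsMultiharmonicBasis.comp_reflectK {b : ℕ} (hb : 1 ≤ b) {j : ℕ} {k : Fin 2}
    {u : C(Fractal b, ℝ)} (hu : IsMultiharmonicBasis j k u) :
    IsMultiharmonicBasis j k.rev (u.comp reflectK) := by
  obtain ⟨v, rfl, hv, hv0, hvb⟩ := hu
  refine ⟨fun m => (v m).comp reflectK, rfl, fun m hm => (hv m hm).comp_reflectK hb, ?_,
    fun m hm n => ?_⟩
  · simp only [hv0]; rfl
  · rw [onVertices_comp_reflectK, Function.comp_apply, reflect, hvb m hm]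
    congr 2
    rw [← Fin.rev_inj, Fin.rev_rev]

/-- The constant in the scaling of the Laplacian. -/
noncomputable def laplaceScale (b : ℕ) : ℝ := renorm b / (b + 2)

theorem laplaceScale_ne_zero {b : ℕ} (hb : 1 ≤ b) : laplaceScale b ≠ 0 := by
  have : (0 : ℝ) < b := by exact_mod_cast hb
  unfold laplaceScale renorm
  positivity

/-! ### Expansion of basis functions on cells -/

section Basis

variable {b : ℕ} {f : ℕ → Fin 2 → C(Fractal b, ℝ)}

theorem isLaplacian_basis_succ (hb : 1 ≤ b) (hf : ∀ j k, IsMultiharmonicBasis j k (f j k))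
    (j : ℕ) (k : Fin 2) : IsLaplacian (f (j + 1) k) (f j k) := by
  obtain ⟨u, hu, h⟩ := (hf (j + 1) k).succ.1
  rwa [hu.unique hb (hf j k)] at h

theorem basis_bdry (hf : ∀ j k, IsMultiharmonicBasis j k (f j k)) (j : ℕ) (k n : Fin 2) :
    onVertices (f j k) (.bdry n) = if j = 0 ∧ n = k then 1 else 0 := by
  cases j with
  | zero => simpa using (hf 0 k).zero.2 n
  | succ j => simpa using (hf (j + 1) k).succ.2 n

/-- The restriction of a basis function to a cell in terms of the basis functions. -/
theorem compF_basis (hb : 1 ≤ b) (hf : ∀ j k, IsMultiharmonicBasis j k (f j k))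
    (i : Fin (b + 2)) (j : ℕ) (k : Fin 2) :
    compF i (f j k) = ∑ ℓ ∈ Finset.range (j + 1), ∑ m,
      (laplaceScale b ^ ℓ * onVertices (f (j - ℓ) k) (F i (.bdry m))) • f ℓ m := by
  -- At a boundary point only the harmonic terms $\ell=0$ survive, and they interpolate the
  -- prescribed values.
  have hval : ∀ j n, onVertices (∑ ℓ ∈ Finset.range (j + 1), ∑ m,
      (laplaceScale b ^ ℓ * onVertices (f (j - ℓ) k) (F i (.bdry m))) • f ℓ m) (.bdry n) =
      onVertices (f j k) (F i (.bdry n)) := by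
    intro j n
    have h : ∀ ℓ m, f ℓ m ((Vertex.bdry n : Vertex b) : Fractal b) =
        if ℓ = 0 ∧ n = m then 1 else 0 := fun ℓ m => basis_bdry hf ℓ m n
    rw [onVertices]
    simp only [ContinuousMap.sum_apply, ContinuousMap.smul_apply, h, smul_eq_mul]
    rw [Finset.sum_range_succ']
    simp
  have hconst : ∀ c : Fin 2 → ℝ, IsLaplacian (∑ m, c m • f 0 m) 0 := by
    intro c
    have h := IsLaplacian.sum hb Finset.univ fun m _ => (hf 0 m).zero.1.smul hb (c m)
    simpa only [smul_zero, Finset.sum_const_zero] using h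
  induction j with
  | zero =>
    have h1 := (hf 0 k).zero.1.compF hb i
    rw [show compF i (0 : C(Fractal b, ℝ)) = 0 from rfl, smul_zero] at h1
    refine h1.unique hb ?_ fun n => ?_
    · rw [zero_add, Finset.sum_range_one]
      exact hconst _
    · rw [hval, onVertices_compF hb]; rfl
  | succ j ih =>
    have h1 := (isLaplacian_basis_succ hb hf j k).compF hb i
    refine h1.unique hb ?_ fun n => ?_
    -- The added 0 is the Laplacian of the harmonic part $\ell=0$. The other terms shift by one
    -- index, and the scaling constant raises $\lambda^\ell$ to $\lambda^{\ell+1}$.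
    · rw [← add_zero ((renorm b / (b + 2)) • compF i (f j k)), ih, Finset.sum_range_succ',
        Finset.smul_sum]
      refine IsLaplacian.add hb (IsLaplacian.sum hb _ fun ℓ _ => ?_) ?_
      · rw [Finset.smul_sum]
        refine IsLaplacian.sum hb _ fun m _ => ?_
        rw [smul_smul, ← mul_assoc, ← laplaceScale, ← pow_succ', Nat.add_sub_add_right]
        exact (isLaplacian_basis_succ hb hf ℓ m).smul hb _
      · exact hconst _
    · rw [hval, onVertices_compF hb]; rfl

theorem basis_rev (hb : 1 ≤ b) (hf : ∀ j k, IsMultiharmonicBasis j k (f j k)) (j : ℕ)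
    (k : Fin 2) : f j k.rev = (f j k).comp reflectK :=
  (hf j k.rev).unique hb ((hf j k).comp_reflectK hb)

theorem basis_rev_apply (hb : 1 ≤ b) (hf : ∀ j k, IsMultiharmonicBasis j k (f j k)) (j : ℕ)
    (k : Fin 2) (p : Vertex b) : onVertices (f j k.rev) (reflect p) = onVertices (f j k) p := by
  rw [basis_rev hb hf, onVertices_comp_reflectK, Function.comp_apply, reflect_involutive]

/-! ### Inner products and their recursion -/

theorem innerProd_basis_rev (hb : 1 ≤ b) (hf : ∀ j k, IsMultiharmonicBasis j k (f j k))
    (j j' : ℕ) (k n : Fin 2) :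
    innerProd (f j k.rev) (f j' n.rev) = innerProd (f j k) (f j' n) := by
  rw [basis_rev hb hf, basis_rev hb hf]
  exact integral_comp_reflectK hb (f j k * f j' n)

/-- The linear functional `u ↦ ∫ u v dμ`. -/
noncomputable def innerProdLeft (hb : 1 ≤ b) (v : C(Fractal b, ℝ)) : C(Fractal b, ℝ) →ₗ[ℝ] ℝ where
  toFun u := innerProd u v
  map_add' u u' := by
    simp only [innerProd, ContinuousMap.add_apply, add_mul]
    exact integral_add (integrable_mul_continuousMap hb _ _) (integrable_mul_continuousMap hb _ _)
  map_smul' c u := by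
    simp only [innerProd, ContinuousMap.smul_apply, smul_eq_mul, mul_assoc, integral_const_mul,
      RingHom.id_apply]

theorem innerProd_comm (u v : C(Fractal b, ℝ)) : innerProd u v = innerProd v u := by
  simp only [innerProd, mul_comm]

theorem innerProd_sum_smul_left (hb : 1 ≤ b) {ι : Type*} (s : Finset ι) (c : ι → ℝ)
    (u : ι → C(Fractal b, ℝ)) (v : C(Fractal b, ℝ)) :
    innerProd (∑ i ∈ s, c i • u i) v = ∑ i ∈ s, c i * innerProd (u i) v := by
  change innerProdLeft hb v _ = _
  simp only [map_sum, map_smul, smul_eq_mul]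
  rfl

theorem innerProd_selfSimilar (hb : 1 ≤ b) (u v : C(Fractal b, ℝ)) :
    innerProd u v = ((b : ℝ) + 2)⁻¹ * ∑ i, innerProd (compF i u) (compF i v) :=
  integral_selfSimilar hb (u * v)

/-- The normalized coefficients of the expansion of a basis function on the cells. -/
noncomputable def cellCoeff (P Q : ℕ → ℝ) (k : Fin 2) (d : ℕ) (i : Fin (b + 2)) (m : Fin 2) : ℝ :=
  Fin.addCases (fun _ => if m = k then P d else Q d)
    (fun c => if m = c then (if d = 0 ∧ m = k then 1 else 0) else if c = k then P d else Q d) i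

/-- The normalized values of the basis functions at the vertices of `G_1`: the value at the new
vertex number `m` of the basis function belonging to the boundary point `0`. -/
noncomputable def innerValue (f : ℕ → Fin 2 → C(Fractal b, ℝ)) (m : Fin 2) (d : ℕ) : ℝ :=
  (laplaceScale b)⁻¹ ^ d * onVertices (f d 0) (.inner [] m)

theorem onVertices_basis_inner (hb : 1 ≤ b) (hf : ∀ j k, IsMultiharmonicBasis j k (f j k))
    (d : ℕ) (k m : Fin 2) : onVertices (f d k) (.inner [] m) =
      laplaceScale b ^ d * if m = k then innerValue f 0 d else innerValue f 1 d := by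
  have hpow : laplaceScale b ^ d * (laplaceScale b)⁻¹ ^ d = 1 := by
    rw [← mul_pow, mul_inv_cancel₀ (laplaceScale_ne_zero hb), one_pow]
  have h0 : ∀ m, onVertices (f d 0) (.inner [] m) = laplaceScale b ^ d * innerValue f m d := by
    intro m
    rw [innerValue, ← mul_assoc, hpow, one_mul]
  have h1 : ∀ m : Fin 2, onVertices (f d 1) (.inner [] m.rev) = onVertices (f d 0) (.inner [] m) :=
    fun m => basis_rev_apply hb hf d 0 (.inner [] m)
  have h10 := h1 0
  have h11 := h1 1
  fin_cases k <;> fin_cases m <;> simp_all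

theorem onVertices_basis_F (hb : 1 ≤ b) (hf : ∀ j k, IsMultiharmonicBasis j k (f j k))
    (d : ℕ) (k m : Fin 2) (i : Fin (b + 2)) : onVertices (f d k) (F i (.bdry m)) =
      laplaceScale b ^ d * cellCoeff (innerValue f 0) (innerValue f 1) k d i m := by
  induction i using Fin.addCases with
  | left i => simp [F, cellCoeff, onVertices_basis_inner hb hf]
  | right c =>
    simp only [F, cellCoeff, Fin.addCases_right]
    by_cases hm : m = c
    · subst hm
      simp only [if_true, basis_bdry hf]
      split_ifs with h
      · simp [h.1]
      · simp
    · simp [hm, onVertices_basis_inner hb hf]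

theorem compF_basis' (hb : 1 ≤ b) (hf : ∀ j k, IsMultiharmonicBasis j k (f j k))
    (i : Fin (b + 2)) (j : ℕ) (k : Fin 2) :
    compF i (f j k) = laplaceScale b ^ j • ∑ ℓ ∈ Finset.range (j + 1), ∑ m,
      cellCoeff (innerValue f 0) (innerValue f 1) k (j - ℓ) i m • f ℓ m := by
  rw [compF_basis hb hf, Finset.smul_sum]
  refine Finset.sum_congr rfl fun ℓ hℓ => ?_
  rw [Finset.smul_sum]
  refine Finset.sum_congr rfl fun m _ => ?_
  rw [onVertices_basis_F hb hf, smul_smul, ← mul_assoc, ← pow_add,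
    Nat.add_sub_cancel' (Nat.lt_succ_iff.1 (Finset.mem_range.1 hℓ))]

/-- The second factor is harmonic on every cell, so only one sum over $\ell$ appears. The scale
$\lambda^\ell$ of a term and the scale $\lambda^{j-\ell}$ of its coefficient combine to $\lambda^j$.
-/
theorem innerProd_basis_recursion (hb : 1 ≤ b) (hf : ∀ j k, IsMultiharmonicBasis j k (f j k))
    (j : ℕ) (k n : Fin 2) :
    innerProd (f j k) (f 0 n) = ((b : ℝ) + 2)⁻¹ * laplaceScale b ^ j *
      ∑ ℓ ∈ Finset.range (j + 1), ∑ i : Fin (b + 2), ∑ m, ∑ m',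
        cellCoeff (innerValue f 0) (innerValue f 1) k (j - ℓ) i m *
          (cellCoeff (innerValue f 0) (innerValue f 1) n 0 i m' * innerProd (f ℓ m) (f 0 m')) := by
  have h : ∀ i, innerProd (compF i (f j k)) (compF i (f 0 n)) = laplaceScale b ^ j *
      ∑ ℓ ∈ Finset.range (j + 1), ∑ m, ∑ m',
        cellCoeff (innerValue f 0) (innerValue f 1) k (j - ℓ) i m *
          (cellCoeff (innerValue f 0) (innerValue f 1) n 0 i m' * innerProd (f ℓ m) (f 0 m')) := by
    intro i
    have h0 : compF i (f 0 n) =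
        ∑ m, cellCoeff (innerValue f 0) (innerValue f 1) n 0 i m • f 0 m := by
      simpa using compF_basis' hb hf i 0 n
    rw [compF_basis' hb hf i j k]
    change innerProdLeft hb _ _ = _
    simp only [map_sum, map_smul, smul_eq_mul]
    congr 1
    refine Finset.sum_congr rfl fun ℓ _ => Finset.sum_congr rfl fun m _ => ?_
    rw [← Finset.mul_sum]
    congr 1
    change innerProd _ _ = _
    rw [h0, innerProd_comm, innerProd_sum_smul_left hb]
    simp only [innerProd_comm]
  rw [innerProd_selfSimilar hb]
  simp only [h]
  rw [← Finset.mul_sum, Finset.sum_comm, mul_assoc]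

theorem innerProd_basis_eq (hb : 1 ≤ b) (hf : ∀ j k, IsMultiharmonicBasis j k (f j k))
    (ℓ : ℕ) (m m' : Fin 2) : innerProd (f ℓ m) (f 0 m') =
      if m = m' then innerProd (f ℓ 0) (f 0 0) else innerProd (f ℓ 0) (f 0 1) := by
  have h1 : innerProd (f ℓ 1) (f 0 1) = innerProd (f ℓ 0) (f 0 0) :=
    innerProd_basis_rev hb hf ℓ 0 0 0
  have h2 : innerProd (f ℓ 1) (f 0 0) = innerProd (f ℓ 0) (f 0 1) :=
    innerProd_basis_rev hb hf ℓ 0 0 1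
  fin_cases m <;> fin_cases m' <;> simp_all

/-! ### Initial values -/

theorem innerValue_zero (hb : 1 ≤ b) (hf : ∀ j k, IsMultiharmonicBasis j k (f j k)) (m : Fin 2) :
    innerValue f m 0 = if m = 0 then ((b : ℝ) + 1) / (2 * b + 1) else b / (2 * b + 1) := by
  have h := (hf 0 0).zero
  rw [innerValue, onVertices_eq_harmonic hb h.1]
  simp only [h.2, harmonic, List.foldl_nil, harmonicMid]
  fin_cases m <;> simp

theorem isLaplacian_one : IsLaplacian (1 : C(Fractal b, ℝ)) 0 := by
  have h1 : ∀ ℓ, graphEnergy ℓ (onVertices (1 : C(Fractal b, ℝ))) = 0 := fun ℓ => by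
    simp [graphEnergy, onVertices]
  have h2 : ∀ ℓ g, graphForm ℓ (onVertices (1 : C(Fractal b, ℝ))) g = 0 := fun ℓ g => by
    simp [graphForm, onVertices]
  refine ⟨energy_ne_top_of_le (C := 0) fun ℓ => (h1 ℓ).le, fun g _ _ => ?_⟩
  simp [energyForm, energy, graphEnergy_add, graphEnergy_sub, h2]

theorem basis_zero_add (hb : 1 ≤ b) (hf : ∀ j k, IsMultiharmonicBasis j k (f j k)) :
    f 0 0 + f 0 1 = 1 := by
  have h := (hf 0 0).zero.1.add hb (hf 0 1).zero.1
  rw [add_zero] at h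
  refine h.unique hb isLaplacian_one fun n => ?_
  have h0 := basis_bdry hf 0 0 n
  have h1 := basis_bdry hf 0 1 n
  simp only [onVertices] at h0 h1 ⊢
  rw [ContinuousMap.add_apply, h0, h1]
  fin_cases n <;> simp

/-- The two harmonic basis functions add up to 1 and have equal integrals by reflection, so each has
integral $\frac12$. -/
theorem innerProd_basis_zero_add (hb : 1 ≤ b) (hf : ∀ j k, IsMultiharmonicBasis j k (f j k)) :
    innerProd (f 0 0) (f 0 0) + innerProd (f 0 0) (f 0 1) = 1 / 2 := by
  have := isProbabilityMeasure_selfSimilarMeasure hb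
  have h1 : innerProd (f 0 0) (f 0 0) + innerProd (f 0 0) (f 0 1) = innerProd (f 0 0) 1 := by
    rw [innerProd_comm _ (f 0 1), innerProd_comm _ 1, ← basis_zero_add hb hf]
    exact (map_add (innerProdLeft hb (f 0 0)) (f 0 0) (f 0 1)).symm
  have h2 : innerProd (f 0 0) 1 + innerProd (f 0 1) 1 = innerProd (1 : C(Fractal b, ℝ)) 1 := by
    have := map_add (innerProdLeft hb 1) (f 0 0) (f 0 1)
    rw [basis_zero_add hb hf] at this
    exact this.symm
  have h3 : innerProd (f 0 1) 1 = innerProd (f 0 0) 1 := by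
    have := integral_comp_reflectK hb (f 0 0 * 1)
    rw [show f 0 1 = f 0 (Fin.rev 0) from rfl, basis_rev hb hf]
    exact this
  have h4 : innerProd (1 : C(Fractal b, ℝ)) 1 = 1 := by simp [innerProd]
  linarith

end Basis

/-! ### Cell sums and the final recursion -/

/-- The factor $b$ collects the identical middle cells; the rest comes from the two end cells. The
case $d=0$ is special because only a harmonic basis function is nonzero at its boundary point. -/
theorem sum_cellCoeff_same {b d : ℕ} (P Q : ℕ → ℝ) (x y : ℝ) :
    (∑ i : Fin (b + 2), ∑ m : Fin 2, ∑ m' : Fin 2, cellCoeff P Q 0 d i m *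
      (cellCoeff P Q 0 0 i m' * if m = m' then x else y)) =
    b * ((P d * P 0 + Q d * Q 0) * x + (P d * Q 0 + Q d * P 0) * y) +
      (P d * P 0 * x + P d * y + Q d * Q 0 * x) + if d = 0 then P 0 * y + x else 0 := by
  rw [Fin.sum_univ_add]
  simp [cellCoeff, Fin.sum_univ_two]
  split_ifs <;> ring

theorem sum_cellCoeff_ne {b d : ℕ} (P Q : ℕ → ℝ) (x y : ℝ) :
    (∑ i : Fin (b + 2), ∑ m : Fin 2, ∑ m' : Fin 2, cellCoeff P Q 0 d i m *
      (cellCoeff P Q 1 0 i m' * if m = m' then x else y)) =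
    b * ((P d * Q 0 + Q d * P 0) * x + (P d * P 0 + Q d * Q 0) * y) +
      (P d * Q 0 * x + Q d * P 0 * x + Q d * y) + if d = 0 then Q 0 * y else 0 := by
  rw [Fin.sum_univ_add]
  simp [cellCoeff, Fin.sum_univ_two]
  split_ifs <;> ring

theorem coeff_mul_laplaceScale_pow {b : ℕ} (hb : 1 ≤ b) (j : ℕ) :
    ((b : ℝ) + 2) ^ (j + 1) * (2 * b + 1) ^ (j + 1) / b ^ j *
      (((b : ℝ) + 2)⁻¹ * laplaceScale b ^ j) = 2 * b + 1 := by
  have hb' : (0 : ℝ) < b := by exact_mod_cast hb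
  unfold laplaceScale renorm
  rw [div_div, div_pow, mul_pow, pow_succ, pow_succ]
  field_simp

end BubbleDiamond

open BubbleDiamond

theorem mainTheorem5 (b : ℕ) (hb : 1 ≤ b) :
    -- existence and uniqueness of the basis functions `f_{jk}`
    (∀ (j : ℕ) (k : Fin 2),
      ∃! u : C(BubbleDiamond.Fractal b, ℝ), BubbleDiamond.IsMultiharmonicBasis j k u) ∧
    ∀ f : ℕ → Fin 2 → C(BubbleDiamond.Fractal b, ℝ),
      (∀ j k, BubbleDiamond.IsMultiharmonicBasis j k (f j k)) →
      ∃ A B p q : ℕ → ℝ,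
        -- the quantities `a_ℓ`, `b_ℓ`, `p_ℓ`, `q_ℓ` (independent of the choice of `k`, `n`, `i`)
        (∀ ℓ k, A ℓ = BubbleDiamond.innerProd (f ℓ k) (f 0 k)) ∧
        (∀ ℓ k n, k ≠ n → B ℓ = BubbleDiamond.innerProd (f ℓ k) (f 0 n)) ∧
        (∀ ℓ k (i : Fin b), p ℓ = (BubbleDiamond.renorm b / (b + 2))⁻¹ ^ ℓ *
          BubbleDiamond.onVertices (f ℓ k) (BubbleDiamond.F (Fin.castAdd 2 i) (.bdry k))) ∧
        (∀ ℓ k n, k ≠ n → p ℓ = (BubbleDiamond.renorm b / (b + 2))⁻¹ ^ ℓ *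
          BubbleDiamond.onVertices (f ℓ k) (BubbleDiamond.F (Fin.natAdd b k) (.bdry n))) ∧
        (∀ ℓ k n (i : Fin b), k ≠ n → q ℓ = (BubbleDiamond.renorm b / (b + 2))⁻¹ ^ ℓ *
          BubbleDiamond.onVertices (f ℓ k) (BubbleDiamond.F (Fin.castAdd 2 i) (.bdry n))) ∧
        -- the initial values
        A 0 = (b + 1) / (2 + 4 * b) ∧ B 0 = b / (2 + 4 * b) ∧
        p 0 = (b + 1) / (2 * b + 1) ∧ q 0 = b / (2 * b + 1) ∧
        -- the recursion
        ∀ j : ℕ, 0 < j →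
          ((b : ℝ) + 2) ^ (j + 1) * (2 * b + 1) ^ (j + 1) / b ^ j * A j =
            (2 * b ^ 3 + 8 * b ^ 2 + 7 * b + 2) / (2 * b + 1) * A j +
            (2 * b ^ 3 + 6 * b ^ 2 + 6 * b + 2) / (2 * b + 1) * B j +
            (b + 1) * ∑ ℓ ∈ Finset.range j,
              (A ℓ + B ℓ) * ((b + 1) * p (j - ℓ) + b * q (j - ℓ)) ∧
          ((b : ℝ) + 2) ^ (j + 1) * (2 * b + 1) ^ (j + 1) / b ^ j * B j =
            (2 * b ^ 3 + 4 * b ^ 2 + 2 * b) / (2 * b + 1) * A j +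
            (2 * b ^ 3 + 6 * b ^ 2 + 3 * b) / (2 * b + 1) * B j +
            (b + 1) * ∑ ℓ ∈ Finset.range j,
              (A ℓ + B ℓ) * (b * p (j - ℓ) + (b + 1) * q (j - ℓ)) := by
  refine ⟨fun j k => ?_, fun f hf => ?_⟩
  · obtain ⟨u, hu⟩ := exists_isMultiharmonicBasis hb j k
    exact ⟨u, hu, fun u' hu' => hu'.unique hb hu⟩
  have hscale : renorm b / (b + 2) = laplaceScale b := rfl
  have hpow : ∀ ℓ (x : ℝ), (laplaceScale b)⁻¹ ^ ℓ * (laplaceScale b ^ ℓ * x) = x := by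
    intro ℓ x
    rw [← mul_assoc, ← mul_pow, inv_mul_cancel₀ (laplaceScale_ne_zero hb), one_pow, one_mul]
  have hb' : (0 : ℝ) < b := by exact_mod_cast hb
  obtain ⟨A, hA⟩ : ∃ A : ℕ → ℝ, ∀ ℓ, A ℓ = innerProd (f ℓ 0) (f 0 0) := ⟨_, fun _ => rfl⟩
  obtain ⟨B, hB⟩ : ∃ B : ℕ → ℝ, ∀ ℓ, B ℓ = innerProd (f ℓ 0) (f 0 1) := ⟨_, fun _ => rfl⟩
  have hAB : A 0 + B 0 = 1 / 2 := by
    rw [hA, hB]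
    exact innerProd_basis_zero_add hb hf
  have hI : ∀ ℓ m m', innerProd (f ℓ m) (f 0 m') = if m = m' then A ℓ else B ℓ := by
    intro ℓ m m'
    rw [hA, hB]
    exact innerProd_basis_eq hb hf ℓ m m'
  set P := innerValue f 0 with hP
  set Q := innerValue f 1 with hQ
  have hP0 : P 0 = (b + 1) / (2 * b + 1) := by rw [hP, innerValue_zero hb hf, if_pos rfl]
  have hQ0 : Q 0 = b / (2 * b + 1) := by rw [hQ, innerValue_zero hb hf, if_neg (by decide)]
  -- The term $\ell=j$ is split off: it alone has $d=j-\ell=0$ and receives the extra boundary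
  -- contribution.
  have hrecA : ∀ j, A j = ((b : ℝ) + 2)⁻¹ * laplaceScale b ^ j *
      ((∑ ℓ ∈ Finset.range j, (b * ((P (j - ℓ) * P 0 + Q (j - ℓ) * Q 0) * A ℓ +
        (P (j - ℓ) * Q 0 + Q (j - ℓ) * P 0) * B ℓ) +
        (P (j - ℓ) * P 0 * A ℓ + P (j - ℓ) * B ℓ + Q (j - ℓ) * Q 0 * A ℓ))) +
      (b * ((P 0 * P 0 + Q 0 * Q 0) * A j + (P 0 * Q 0 + Q 0 * P 0) * B j) +
        (P 0 * P 0 * A j + P 0 * B j + Q 0 * Q 0 * A j) + (P 0 * B j + A j))) := by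
    intro j
    have h := innerProd_basis_recursion hb hf j 0 0
    simp only [hI, sum_cellCoeff_same] at h
    rw [if_true, Finset.sum_range_succ, Nat.sub_self, if_pos rfl] at h
    refine h.trans ?_
    congr 2
    refine Finset.sum_congr rfl fun ℓ hℓ => ?_
    rw [if_neg (by have := Finset.mem_range.1 hℓ; omega), add_zero]
  have hrecB : ∀ j, B j = ((b : ℝ) + 2)⁻¹ * laplaceScale b ^ j *
      ((∑ ℓ ∈ Finset.range j, (b * ((P (j - ℓ) * Q 0 + Q (j - ℓ) * P 0) * A ℓ +
        (P (j - ℓ) * P 0 + Q (j - ℓ) * Q 0) * B ℓ) +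
        (P (j - ℓ) * Q 0 * A ℓ + Q (j - ℓ) * P 0 * A ℓ + Q (j - ℓ) * B ℓ))) +
      (b * ((P 0 * Q 0 + Q 0 * P 0) * A j + (P 0 * P 0 + Q 0 * Q 0) * B j) +
        (P 0 * Q 0 * A j + Q 0 * P 0 * A j + Q 0 * B j) + Q 0 * B j)) := by
    intro j
    have h := innerProd_basis_recursion hb hf j 0 1
    simp only [hI, sum_cellCoeff_ne] at h
    rw [if_neg (by decide), Finset.sum_range_succ, Nat.sub_self, if_pos rfl] at h
    refine h.trans ?_
    congr 2
    refine Finset.sum_congr rfl fun ℓ hℓ => ?_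
    rw [if_neg (by have := Finset.mem_range.1 hℓ; omega), add_zero]
  have hA0 : A 0 = (b + 1) / (2 + 4 * b) := by
    -- At level 0 the relation is homogeneous in $a_0,b_0$; substituting $b_0=\frac12-a_0$ makes it
    -- determine $a_0$.
    have h := hrecA 0
    rw [show B 0 = 1 / 2 - A 0 by linarith, hP0, hQ0] at h
    simp only [Finset.range_zero, Finset.sum_empty, pow_zero] at h
    field_simp at h
    rw [eq_div_iff (by positivity)]
    -- After clearing denominators the equation has the superfluous common factor $(b+1)^2$.
    have h2 : ((b : ℝ) + 1) ^ 2 * (A 0 * (2 + 4 * b)) = (b + 1) ^ 2 * (b + 1) := by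
      linear_combination h / 2
    exact mul_left_cancel₀ (by positivity : ((b : ℝ) + 1) ^ 2 ≠ 0) h2
  refine ⟨A, B, P, Q, fun ℓ k => ?_, fun ℓ k n hkn => ?_, fun ℓ k i => ?_, fun ℓ k n hkn => ?_,
    fun ℓ k n i hkn => ?_, hA0, ?_, hP0, hQ0, fun j _ => ⟨?_, ?_⟩⟩
  · rw [hI, if_pos rfl]
  · rw [hI, if_neg hkn]
  · rw [hscale, onVertices_basis_F hb hf, hpow]
    simp [cellCoeff, hP]
  · rw [hscale, onVertices_basis_F hb hf, hpow]
    simp [cellCoeff, hP, hkn.symm]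
  · rw [hscale, onVertices_basis_F hb hf, hpow]
    simp [cellCoeff, hQ, hkn.symm]
  · rw [show B 0 = 1 / 2 - A 0 by linarith, hA0]
    field_simp
    ring
  · conv_lhs => rw [hrecA j]
    rw [← mul_assoc, coeff_mul_laplaceScale_pow hb, hP0, hQ0, mul_add, Finset.mul_sum,
      Finset.mul_sum, add_comm]
    congr 1
    · field_simp
      ring
    -- With the explicit $p_0,q_0$ inserted, $a_\ell$ and $b_\ell$ acquire the same coefficient
    -- $(b+1)\big((b+1)p_{j-\ell}+b\,q_{j-\ell}\big)$, which is why only $a_\ell+b_\ell$ enters.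
    · refine Finset.sum_congr rfl fun ℓ _ => ?_
      field_simp
      ring
  · conv_lhs => rw [hrecB j]
    rw [← mul_assoc, coeff_mul_laplaceScale_pow hb, hP0, hQ0, mul_add, Finset.mul_sum,
      Finset.mul_sum, add_comm]
    congr 1
    · field_simp
      ring
    · refine Finset.sum_congr rfl fun ℓ _ => ?_
      field_simp
      ring
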